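/- Let $\Omega\subseteq\mathbb{C}$ be a domain and let $\beta,\delta$ be analytic on $\Omega$. For $a,b,c\in\mathbb{C}$ consider $$y''=3y^5+(az+b)\,y^3+\beta(z)\,y^2+\Big(\tfrac1{16}(az+b)^2+c\Big)y+\delta(z).\qquad(*)$$ (1) These are exactly the equations $y''=3y^5+\alpha(z)y^3+\beta(z)y^2+\gamma(z)y+\delta(z)$, with $\alpha,\gamma$ analytic on $\Omega$, that satisfy both resonance conditions $\alpha''\equiv0$ and $(\alpha^2-16\gamma)'\equiv0$ on $\Omega$. (2) Every equation $(*)$ has the quasi-Painlevé property with square-root type algebraic poles. That is: let $p:[0,1]\to\Omega$ be a path of finite length with endpoint $z_*=p(1)$, and let a local analytic solution of $(*)$ near $p(0)$ be continued analytically along $p$ up to, but not including, $z_*$, where the continuation is singular (it does not extend analytically to $z_*$). Then, near the end of $p$, the continuation is represented by a convergent Puiseux series $$y(z)=\sum_{j=0}^\infty c_j\,(z-z_*)^{(j-1)/2},\qquad c_0\neq0,$$ where the branch of $(z-z_*)^{1/2}$ is followed continuously along $p$. In particular it is an algebraic pole for which $2$ is the minimal denominator: it is not represented there by a Laurent series in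 $z-z_*$ with finite principal part. -/

import Mathlib

open Set Filter Topology

/-- `F` is an analytic continuation, along the half-open path `γ` on `[0, 1)`, of the function
element `F 0` at `γ 0`: for each `s ∈ [0, 1)` there is a function element `F s`, analytic at `γ s`,
and for all `s' ∈ [0, 1)` close to `s` the germ of `F s'` at `γ s'` is the germ there of `F s`. -/
structure IsAnalyticContinuationAlong (γ : ℝ → ℂ) (F : ℝ → ℂ → ℂ) : Prop where
  analyticAt : ∀ s ∈ Ico (0 : ℝ) 1, AnalyticAt ℂ (F s) (γ s)
  compatible : ∀ s ∈ Ico (0 : ℝ) 1, ∀ᶠ s' in 𝓝[Ico (0 : ℝ) 1] s, F s' =ᶠ[𝓝 (γ s')] F s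

/-- A finite-length path `γ : [0, 1] → Ω` along which a local analytic solution `F 0` of
`y'' = P(z, y)` near `γ 0` can be continued analytically up to, but not including, the endpoint
`γ 1`, which is a singularity of the continuation: no function analytic at `γ 1` agrees with the
function elements `F s` at the points `γ s`, `s → 1`.

When `P` is analytic on `Ω × ℂ`, the equation has no fixed singularities in `Ω`, so all such
singularities are movable. -/
structure ReachesMovableSingularity (Ω : Set ℂ) (P : ℂ → ℂ → ℂ) (γ : ℝ → ℂ) (F : ℝ → ℂ → ℂ) :
    Prop where
  continuousOn : ContinuousOn γ (Icc 0 1)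
  finite_length : BoundedVariationOn γ (Icc 0 1)
  mapsTo : MapsTo γ (Icc 0 1) Ω
  continuation : IsAnalyticContinuationAlong γ F
  solution : ∀ᶠ z in 𝓝 (γ 0), deriv (deriv (F 0)) z = P z (F 0 z)
  singular : ¬ ∃ h : ℂ → ℂ, AnalyticAt ℂ h (γ 1) ∧ ∀ᶠ s in 𝓝[<] (1 : ℝ), F s =ᶠ[𝓝 (γ s)] h

/-- Near the end of `γ`, the continuation `F` is represented by the Puiseux series
`∑ j, c j * (z - z⋆) ^ ((j - j₀) / n)` at `z⋆ = γ 1`, convergent in a punctured neighbourhood of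
`z⋆`. Here `τ s` is the value at `γ s` of the branch of `(z - z⋆) ^ (1 / n)`, followed
continuously along `γ` (which may wind around `z⋆`), and the local coordinate
`t = (z - z⋆) ^ (1 / n)`, that is `z = z⋆ + t ^ n`, is used near `γ s`. -/
def HasPuiseuxExpansion (γ : ℝ → ℂ) (F : ℝ → ℂ → ℂ) (n j₀ : ℕ) (c : ℕ → ℂ) : Prop :=
  ∃ R > (0 : ℝ),
    (∀ t : ℂ, 0 < ‖t‖ → ‖t‖ < R → Summable fun j : ℕ => c j * t ^ ((j : ℤ) - (j₀ : ℤ))) ∧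
    ∃ s₀ ∈ Ico (0 : ℝ) 1, ∃ τ : ℝ → ℂ, ContinuousOn τ (Ico s₀ 1) ∧
      ∀ s ∈ Ico s₀ 1, τ s ≠ 0 ∧ ‖τ s‖ < R ∧ γ s = γ 1 + τ s ^ n ∧
        ∀ᶠ t in 𝓝 (τ s),
          HasSum (fun j : ℕ => c j * t ^ ((j : ℤ) - (j₀ : ℤ))) (F s (γ 1 + t ^ n))

/-- At the endpoint of `γ` the continuation `F` has an `n`-th-root type algebraic pole: a Puiseux
series in `(z - z⋆) ^ (1 / n)` with a leading term of negative exponent, `n` being minimal.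
For `n = 1` this is an ordinary pole. -/
def HasRootTypeAlgebraicPole (n : ℕ) (γ : ℝ → ℂ) (F : ℝ → ℂ → ℂ) : Prop :=
  0 < n ∧
  (∃ (j₀ : ℕ) (c : ℕ → ℂ), 0 < j₀ ∧ c 0 ≠ 0 ∧ HasPuiseuxExpansion γ F n j₀ c) ∧
  ∀ m : ℕ, 0 < m → m < n → ∀ (j₀ : ℕ) (c : ℕ → ℂ), ¬ HasPuiseuxExpansion γ F m j₀ c

/-- `y'' = P(z, y)`, with coefficients analytic on `Ω`, has the quasi-Painlevé property with
`n`-th-root type algebraic poles: every movable singularity obtained by analytic continuation of a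
local solution along a finite-length path is an `n`-th-root type algebraic pole. -/
def HasQuasiPainleveProperty (Ω : Set ℂ) (P : ℂ → ℂ → ℂ) (n : ℕ) : Prop :=
  ∀ (γ : ℝ → ℂ) (F : ℝ → ℂ → ℂ),
    ReachesMovableSingularity Ω P γ F → HasRootTypeAlgebraicPole n γ F

/-- The right-hand side of `y'' = 3 y⁵ + α(z) y³ + β(z) y² + γ(z) y + δ(z)`. -/
def quinticRHS (α β γ δ : ℂ → ℂ) (z y : ℂ) : ℂ :=
  3 * y ^ 5 + α z * y ^ 3 + β z * y ^ 2 + γ z * y + δ z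

/-- The two resonance conditions `α'' ≡ 0` and `(α² - 16 γ)' ≡ 0` on `Ω` for the equation
`y'' = 3 y⁵ + α(z) y³ + β(z) y² + γ(z) y + δ(z)`. -/
def QuinticResonanceConditions (Ω : Set ℂ) (α γ : ℂ → ℂ) : Prop :=
  (∀ z ∈ Ω, deriv (deriv α) z = 0) ∧ (∀ z ∈ Ω, deriv (fun w => α w ^ 2 - 16 * γ w) z = 0)

/-!
Write `α = a z + b`, `γ = (a z + b)² / 16 + c`, and consider a solution `y` continued along a path of
finite length which ends at a singularity `z⋆`.

*The energy.* For constant coefficients `E = y'² - potential` is a first integral. In general the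
derivative of `E` contains terms in `y⁴`, `y³`, `y²` and `y`. As `(y' / yᵏ)' = (3 - k) y⁵⁻ᵏ + …`, they
are removed by adding multiples of `y' / y`, `y' / y²`, `1 / y` and `y' / y⁴` to `E`; only the exponent
`k = 3`, that is the term in `y²`, is resonant, and its coefficient vanishes by the resonance conditions.
The resulting function `W` (`modifiedEnergy`) satisfies a linear differential inequality as long as
`y` stays away from `0` (`hasDerivAt_modifiedEnergy`). The path may however come close to zeros of
`y`. Instead of deforming it, the corrections are multiplied by a smooth cutoff that vanishes near
`y = 0`. The outcome is no longer holomorphic, but it still satisfies `|dW| ≤ C (1 + |W|) |dz|`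
everywhere (`exists_energy_growth_bound`), because for bounded `y` the derivative is `O(1 + |y'|²)`
while `|W| ≥ |y'|² / 2 - C`. Hence `W` is bounded along the path
(`exists_norm_le_of_boundedVariationOn`).

*Behaviour at the singularity.* By an existence theorem with a uniform radius, the pair `(y, y')`
cannot stay bounded along a sequence of points tending to `z⋆`; as `W` is bounded, this forces
`y → ∞`, and then `v = y' / y³` has only the limit points `±1`. In terms of the independent variable
`u = 1 / y`, the unknowns `(z, W, v)` satisfy a system (`regularizedField`) that is analytic also at
`u = 0`, where `v ≠ 0`. The uniform existence theorem, applied to this system, shows that `z` is an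
analytic function of `u` in a full neighbourhood of `u = 0`
(`ReachesMovableSingularity.exists_inverse`), with `dz / du = -u / v`. So `z - z⋆ = T(u)²` for a local
coordinate `T`, and `y = 1 / u` is a Laurent series with a simple pole in `t = (z - z⋆) ^ (1 / 2)`
(`exists_hasPuiseuxExpansion_of_inverse`). A function with a simple pole in `t` is not even in `t`, so
the denominator `2` is minimal (`not_hasPuiseuxExpansion_one`).
-/

/-! ### Holomorphic initial value problems -/

/-- Local existence for `X' = f(ζ, X)` in the complex domain. The disc of existence does not depend
on the initial data, as long as these are close to a given point; in particular it contains the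
given point `ζ₀`. The solution comes from Picard iteration, each step being a primitive on a
disc. -/
theorem exists_forall_mem_ball_hasDerivAt {E : Type*} [NormedAddCommGroup E] [NormedSpace ℂ E]
    [CompleteSpace E] {f : ℂ × E → E} {ζ₀ : ℂ} {X₀ : E} (hf : ContDiffAt ℂ 1 f (ζ₀, X₀))
    {N : Set (ℂ × E)} (hN : N ∈ 𝓝 (ζ₀, X₀)) :
    ∃ r > (0 : ℝ), ∀ᶠ q in 𝓝 (ζ₀, X₀), ∃ X : ℂ → E, X q.1 = q.2 ∧
      ∀ ζ ∈ Metric.ball ζ₀ r, HasDerivAt X (f (ζ, X ζ)) ζ ∧ (ζ, X ζ) ∈ N := by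
  obtain ⟨K, t, ht, hK⟩ := hf.exists_lipschitzOnWith
  have hdiff : ∀ᶠ q in 𝓝 (ζ₀, X₀), DifferentiableAt ℂ f q :=
    (hf.eventually (by simp)).mono fun q hq => hq.differentiableAt one_ne_zero
  have hbd : ∀ᶠ q in 𝓝 (ζ₀, X₀), ‖f q‖ < ‖f (ζ₀, X₀)‖ + 1 :=
    hf.continuousAt.norm.eventually (gt_mem_nhds (lt_add_one _))
  obtain ⟨ρ, hρ, hball⟩ := Metric.mem_nhds_iff.1
    (inter_mem (inter_mem ht hN) (inter_mem hdiff hbd))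
  set M : ℝ := ‖f (ζ₀, X₀)‖ + 1 with hM
  have hMpos : 0 < M := by positivity
  obtain ⟨r, hr, hrρ, hrM, hrK⟩ : ∃ r > (0 : ℝ), r ≤ ρ ∧ 2 * r * M ≤ ρ / 4 ∧
      2 * r * K ≤ 1 / 2 := by
    refine ⟨min ρ (min (ρ / (8 * M)) (1 / (4 * (K + 1)))), by positivity, min_le_left _ _, ?_, ?_⟩
    · have : min ρ (min (ρ / (8 * M)) (1 / (4 * (K + 1)))) ≤ ρ / (8 * M) :=
        (min_le_right _ _).trans (min_le_left _ _)
      rw [le_div_iff₀ (by positivity)] at this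
      linarith
    · have : min ρ (min (ρ / (8 * M)) (1 / (4 * ((K : ℝ) + 1)))) ≤ 1 / (4 * (K + 1)) :=
        (min_le_right _ _).trans (min_le_right _ _)
      have h2 : 0 ≤ min ρ (min (ρ / (8 * M)) (1 / (4 * ((K : ℝ) + 1)))) := by positivity
      rw [le_div_iff₀ (by positivity)] at this
      nlinarith
  refine ⟨r, hr, ?_⟩
  have hnear : ∀ᶠ q in 𝓝 (ζ₀, X₀), q ∈ Metric.ball ζ₀ r ×ˢ Metric.ball X₀ (ρ / 2) :=
    prod_mem_nhds (Metric.ball_mem_nhds _ hr) (Metric.ball_mem_nhds _ (by positivity))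
  filter_upwards [hnear] with q hq
  obtain ⟨ζ₁, X₁⟩ := q
  obtain ⟨hζ₁, hX₁⟩ := hq
  simp only at hζ₁ hX₁ ⊢
  set B := Metric.ball ζ₀ r with hB
  have hin : ∀ ζ ∈ B, ∀ x : E, ‖x - X₁‖ ≤ ρ / 4 → (ζ, x) ∈ Metric.ball (ζ₀, X₀) ρ := by
    intro ζ hζ x hx
    rw [← ball_prod_same]
    refine ⟨Metric.ball_subset_ball hrρ hζ, ?_⟩
    rw [Metric.mem_ball] at hX₁ ⊢
    calc dist x X₀ ≤ dist x X₁ + dist X₁ X₀ := dist_triangle _ _ _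
      _ < ρ / 4 + ρ / 2 := add_lt_add_of_le_of_lt (by rwa [dist_eq_norm]) hX₁
      _ < ρ := by linarith
  have hdist : ∀ ζ ∈ B, ‖ζ - ζ₁‖ ≤ 2 * r := by
    intro ζ hζ
    rw [← dist_eq_norm]
    rw [hB, Metric.mem_ball] at hζ hζ₁
    linarith [dist_triangle_right ζ ζ₁ ζ₀]
  have hmv : ∀ (g g' : ℂ → E) (C : ℝ), (∀ ζ ∈ B, HasDerivAt g (g' ζ) ζ) →
      (∀ ζ ∈ B, ‖g' ζ‖ ≤ C) → ∀ ζ ∈ B, ‖g ζ - g ζ₁‖ ≤ C * (2 * r) := by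
    intro g g' C hg hC ζ hζ
    refine ((convex_ball ζ₀ r).norm_image_sub_le_of_norm_hasDerivWithin_le
      (fun x hx => (hg x hx).hasDerivWithinAt) hC hζ₁ hζ).trans ?_
    exact mul_le_mul_of_nonneg_left (hdist ζ hζ) ((norm_nonneg _).trans (hC ζ hζ))
  let Good : (ℂ → E) → Prop := fun g => ∀ ζ ∈ B, DifferentiableAt ℂ g ζ ∧ ‖g ζ - X₁‖ ≤ ρ / 4
  have hstep : ∀ g : {g // Good g}, ∃ g' : {g // Good g}, g'.1 ζ₁ = X₁ ∧
      ∀ ζ ∈ B, HasDerivAt g'.1 (f (ζ, g.1 ζ)) ζ := by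
    rintro ⟨g, hg⟩
    have hd : DifferentiableOn ℂ (fun ζ => f (ζ, g ζ)) B := by
      intro ζ hζ
      have h1 : DifferentiableAt ℂ f (ζ, g ζ) := (hball (hin ζ hζ _ (hg ζ hζ).2)).2.1
      have h2 : DifferentiableAt ℂ (fun ζ => (ζ, g ζ)) ζ :=
        differentiableAt_id.prodMk (hg ζ hζ).1
      exact (h1.comp ζ h2).differentiableWithinAt
    obtain ⟨g', hg'0, hg'⟩ := hd.isExactOn_ball.with_val_at ζ₁ X₁
    refine ⟨⟨g', fun ζ hζ => ⟨(hg' ζ hζ).differentiableAt, ?_⟩⟩, hg'0, hg'⟩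
    have := hmv g' _ M hg' (fun ζ hζ => (hball (hin ζ hζ _ (hg ζ hζ).2)).2.2.le) ζ hζ
    rw [hg'0] at this
    linarith
  choose Φ hΦ0 hΦ using hstep
  let g₀ : {g // Good g} := ⟨fun _ => X₁, fun ζ _ => ⟨differentiableAt_const _, by simp; positivity⟩⟩
  let S : ℕ → {g // Good g} := fun n => Φ^[n] g₀
  have hS : ∀ n, S (n + 1) = Φ (S n) := fun n => Function.iterate_succ_apply' Φ n g₀
  have hlip : ∀ ζ ∈ B, ∀ x y : E, ‖x - X₁‖ ≤ ρ / 4 → ‖y - X₁‖ ≤ ρ / 4 →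
      ‖f (ζ, x) - f (ζ, y)‖ ≤ K * ‖x - y‖ := by
    intro ζ hζ x y hx hy
    have := hK.norm_sub_le (hball (hin ζ hζ x hx)).1.1 (hball (hin ζ hζ y hy)).1.1
    simpa [Prod.norm_def] using this
  have hgeo : ∀ n, ∀ ζ ∈ B, ‖(S (n + 1)).1 ζ - (S n).1 ζ‖ ≤ ρ / 4 * (1 / 2) ^ n := by
    intro n
    induction n with
    | zero =>
      intro ζ hζ
      simpa [S, g₀] using ((S 1).2 ζ hζ).2
    | succ n ih =>
      intro ζ hζ
      have h1 : ∀ ζ ∈ B, HasDerivAt (fun ζ => (S (n + 2)).1 ζ - (S (n + 1)).1 ζ)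
          (f (ζ, (S (n + 1)).1 ζ) - f (ζ, (S n).1 ζ)) ζ := by
        intro ζ hζ
        rw [hS (n + 1), hS n]
        have := (hΦ (Φ (S n)) ζ hζ).sub (hΦ (S n) ζ hζ)
        exact this
      have h2 := hmv _ _ (K * (ρ / 4 * (1 / 2) ^ n)) h1 (fun ζ hζ =>
        (hlip ζ hζ _ _ ((S (n + 1)).2 ζ hζ).2 ((S n).2 ζ hζ).2).trans
          (mul_le_mul_of_nonneg_left (ih ζ hζ) K.2)) ζ hζ
      have h3 : (S (n + 2)).1 ζ₁ - (S (n + 1)).1 ζ₁ = 0 := by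
        rw [hS (n + 1), hS n, hΦ0, hΦ0, sub_self]
      rw [h3, sub_zero] at h2
      refine h2.trans ?_
      have h4 : 0 ≤ ρ / 4 * (1 / 2 : ℝ) ^ n := by positivity
      calc K * (ρ / 4 * (1 / 2) ^ n) * (2 * r) = (2 * r * K) * (ρ / 4 * (1 / 2) ^ n) := by ring
        _ ≤ 1 / 2 * (ρ / 4 * (1 / 2) ^ n) := mul_le_mul_of_nonneg_right hrK h4
        _ = ρ / 4 * (1 / 2) ^ (n + 1) := by ring
  have hgeo' : ∀ ζ ∈ B, ∀ n, dist ((S n).1 ζ) ((S (n + 1)).1 ζ) ≤ ρ / 4 * (1 / 2) ^ n := by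
    intro ζ hζ n
    rw [dist_comm, dist_eq_norm]
    exact hgeo n ζ hζ
  have hlim : ∀ ζ : ℂ, ∃ x : E, ζ ∈ B → Tendsto (fun n => (S n).1 ζ) atTop (𝓝 x) := by
    intro ζ
    by_cases hζ : ζ ∈ B
    · obtain ⟨x, hx⟩ := cauchySeq_tendsto_of_complete
        (cauchySeq_of_le_geometric (1 / 2) (ρ / 4) (by norm_num) (hgeo' ζ hζ))
      exact ⟨x, fun _ => hx⟩
    · exact ⟨0, fun h => absurd h hζ⟩
  choose X hX using hlim
  have hXin : ∀ ζ ∈ B, ‖X ζ - X₁‖ ≤ ρ / 4 := fun ζ hζ =>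
    le_of_tendsto ((hX ζ hζ).sub_const X₁).norm (Eventually.of_forall fun n => ((S n).2 ζ hζ).2)
  refine ⟨X, ?_, fun ζ hζ => ⟨?_, (hball (hin ζ hζ _ (hXin ζ hζ))).1.2⟩⟩
  · refine tendsto_nhds_unique (hX ζ₁ hζ₁) (tendsto_const_nhds.congr fun n => ?_)
    cases n with
    | zero => rfl
    | succ n => rw [hS, hΦ0]
  · have hunif : TendstoUniformlyOn (fun n ζ => f (ζ, (S n).1 ζ)) (fun ζ => f (ζ, X ζ)) atTop B := by
      rw [Metric.tendstoUniformlyOn_iff]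
      intro ε hε
      have hlim0 : Tendsto (fun n : ℕ => K * (ρ / 4 * (1 / 2) ^ n / (1 - 1 / 2))) atTop (𝓝 0) := by
        have := (tendsto_pow_atTop_nhds_zero_of_lt_one (by norm_num : (0 : ℝ) ≤ 1 / 2)
          (by norm_num)).const_mul (K * (ρ / 4) / (1 - 1 / 2))
        rw [mul_zero] at this
        refine this.congr fun n => by ring
      filter_upwards [hlim0.eventually (gt_mem_nhds hε)] with n hn ζ hζ
      rw [dist_comm, dist_eq_norm]
      refine lt_of_le_of_lt (hlip ζ hζ _ _ ((S n).2 ζ hζ).2 (hXin ζ hζ)) (lt_of_le_of_lt ?_ hn)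
      refine mul_le_mul_of_nonneg_left ?_ K.2
      rw [← dist_eq_norm]
      exact dist_le_of_le_geometric_of_tendsto (1 / 2) (ρ / 4) (by norm_num) (hgeo' ζ hζ)
        (hX ζ hζ) n
    refine hasDerivAt_of_tendstoUniformlyOn (f := fun n => (S (n + 1)).1) Metric.isOpen_ball hunif
      (Eventually.of_forall fun n x hx => ?_) (fun x hx => ?_) hζ
    · rw [hS]
      exact hΦ (S n) x hx
    · exact (hX x hx).comp (tendsto_add_atTop_nat 1)

/-- Local uniqueness for `X' = f(z, X)` in the complex domain. -/
theorem eventuallyEq_of_hasDerivAt {E : Type*} [NormedAddCommGroup E] [NormedSpace ℂ E]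
    {f : ℂ × E → E} {z₀ : ℂ} {X Y : ℂ → E} (hf : ContDiffAt ℂ 1 f (z₀, X z₀))
    (hX : ∀ᶠ z in 𝓝 z₀, HasDerivAt X (f (z, X z)) z)
    (hY : ∀ᶠ z in 𝓝 z₀, HasDerivAt Y (f (z, Y z)) z) (hXY : X z₀ = Y z₀) : X =ᶠ[𝓝 z₀] Y := by
  obtain ⟨K, t, ht, hK⟩ := hf.exists_lipschitzOnWith
  have cX : ContinuousAt X z₀ := hX.self_of_nhds.continuousAt
  have cY : ContinuousAt Y z₀ := hY.self_of_nhds.continuousAt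
  have htX : ∀ᶠ z in 𝓝 z₀, (z, X z) ∈ t := (continuousAt_id.prodMk cX).eventually ht
  have htY : ∀ᶠ z in 𝓝 z₀, (z, Y z) ∈ t :=
    (continuousAt_id.prodMk cY).eventually (show t ∈ 𝓝 (z₀, Y z₀) from hXY ▸ ht)
  have hd : ∀ᶠ z in 𝓝 z₀, ‖X z - Y z‖ < 1 := by
    refine (cX.sub cY).norm.eventually (gt_mem_nhds ?_)
    simp [hXY]
  obtain ⟨ρ, hρ, hball⟩ := Metric.eventually_nhds_iff_ball.1
    (hX.and (hY.and (htX.and (htY.and hd))))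
  set r : ℝ := min ρ (1 / (2 * (K + 1)))
  have hr : 0 < r := by positivity
  have hrK : K * r ≤ 1 / 2 := by
    have : r ≤ 1 / (2 * (K + 1)) := min_le_right _ _
    rw [le_div_iff₀ (by positivity)] at this
    nlinarith
  have hb : ∀ n : ℕ, ∀ z ∈ Metric.ball z₀ r, ‖X z - Y z‖ ≤ (1 / 2) ^ n := by
    intro n
    induction n with
    | zero =>
      intro z hz
      simpa using (hball z (Metric.ball_subset_ball (min_le_left _ _) hz)).2.2.2.2.le
    | succ n ih =>
      intro z hz
      have := (convex_ball z₀ r).norm_image_sub_le_of_norm_hasDerivWithin_le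
        (f := fun z => X z - Y z) (f' := fun z => f (z, X z) - f (z, Y z)) (C := K * (1 / 2) ^ n)
        (fun x hx => ?_) (fun x hx => ?_) (Metric.mem_ball_self hr) hz
      · simp only [hXY, sub_self, sub_zero] at this
        rw [Metric.mem_ball, dist_eq_norm] at hz
        refine this.trans ?_
        have h2 : (0 : ℝ) ≤ (1 / 2) ^ n := by positivity
        calc K * (1 / 2) ^ n * ‖z - z₀‖ ≤ K * (1 / 2) ^ n * r := by gcongr
          _ = K * r * (1 / 2) ^ n := by ring
          _ ≤ 1 / 2 * (1 / 2) ^ n := by gcongr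
          _ = (1 / 2) ^ (n + 1) := by ring
      · obtain ⟨h1, h2, -⟩ := hball x (Metric.ball_subset_ball (min_le_left _ _) hx)
        exact (h1.sub h2).hasDerivWithinAt
      · obtain ⟨-, -, h3, h4, -⟩ := hball x (Metric.ball_subset_ball (min_le_left _ _) hx)
        have h5 := hK.norm_sub_le h3 h4
        refine h5.trans (mul_le_mul_of_nonneg_left ?_ K.2)
        simpa [Prod.norm_def] using ih x hx
  filter_upwards [Metric.ball_mem_nhds z₀ hr] with z hz
  have := ge_of_tendsto' (tendsto_pow_atTop_nhds_zero_of_lt_one (by norm_num : (0 : ℝ) ≤ 1 / 2)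
    (by norm_num)) fun n => hb n z hz
  exact sub_eq_zero.1 (norm_le_zero_iff.1 this)

/-! ### Function elements along a path -/

/-- Permanence of functional relations under analytic continuation along a path: the elements `G s`
all vanish if the first one does. -/
theorem eventuallyEq_zero_of_continuation {γ : ℝ → ℂ} {G : ℝ → ℂ → ℂ} {a b : ℝ}
    (hγ : ContinuousOn γ (Ico a b)) (hG : ∀ s ∈ Ico a b, AnalyticAt ℂ (G s) (γ s))
    (hcomp : ∀ s ∈ Ico a b, ∀ᶠ s' in 𝓝[Ico a b] s, G s' =ᶠ[𝓝 (γ s')] G s)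
    (h0 : G a =ᶠ[𝓝 (γ a)] 0) : ∀ s ∈ Ico a b, G s =ᶠ[𝓝 (γ s)] 0 := by
  intro s hs
  have ha : a ∈ Ico a b := ⟨le_rfl, hs.1.trans_lt hs.2⟩
  refine (isPreconnected_Ico.induction₂ (fun x y => G x =ᶠ[𝓝 (γ x)] 0 ↔ G y =ᶠ[𝓝 (γ y)] 0)
    (fun x hx => ?_) (fun x y z _ _ _ h1 h2 => h1.trans h2) (fun x y _ _ h => h.symm) ha hs).1 h0
  obtain ⟨ρ, hρ, hball⟩ := Metric.eventually_nhds_iff_ball.1 (hG x hx).eventually_analyticAt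
  have hmem : ∀ᶠ s' in 𝓝[Ico a b] x, γ s' ∈ Metric.ball (γ x) ρ :=
    (hγ x hx).eventually (Metric.ball_mem_nhds _ hρ)
  have key : ∀ z ∈ Metric.ball (γ x) ρ, ∀ w ∈ Metric.ball (γ x) ρ, G x =ᶠ[𝓝 z] 0 →
      G x =ᶠ[𝓝 w] 0 := fun z hz w hw h =>
    (AnalyticOnNhd.eqOn_zero_of_preconnected_of_eventuallyEq_zero hball
      (convex_ball _ _).isPreconnected hz h).eventuallyEq_of_mem (Metric.isOpen_ball.mem_nhds hw)
  filter_upwards [hcomp x hx, hmem] with s' h1 h2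
  exact ⟨fun h => h1.trans (key _ (Metric.mem_ball_self hρ) _ h2 h),
    fun h => key _ h2 _ (Metric.mem_ball_self hρ) (h1.symm.trans h)⟩

/-- If `φ` locally grows to the right no faster than the (possibly discontinuous) monotone function
`ℓ`, it does so globally. -/
theorem sub_le_sub_of_local_growth {φ ℓ : ℝ → ℝ} {a b : ℝ} (hφ : ContinuousOn φ (Ico a b))
    (hℓ : MonotoneOn ℓ (Ico a b))
    (h : ∀ s ∈ Ico a b, ∀ᶠ s' in 𝓝[Ico a b] s, s ≤ s' → φ s' - φ s ≤ ℓ s' - ℓ s) :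
    ∀ s ∈ Ico a b, φ s - φ a ≤ ℓ s - ℓ a := by
  intro c hc
  have hcI : Icc a c ⊆ Ico a b := fun x hx => ⟨hx.1, hx.2.trans_lt hc.2⟩
  let S : Set ℝ := {s | ∀ s' ∈ Icc a s, φ s' - φ a ≤ ℓ s' - ℓ a}
  suffices hS : Icc a c ⊆ S from hS ⟨hc.1, le_rfl⟩ c ⟨hc.1, le_rfl⟩
  refine IsClosed.Icc_subset_of_forall_exists_gt ?_ ?_ ?_
  · refine isClosed_of_closure_subset fun s hs => ?_
    have hsI : s ∈ Icc a c := isClosed_Icc.closure_subset (closure_mono inter_subset_right hs)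
    have hlt : ∀ s' ∈ Ico a s, φ s' - φ a ≤ ℓ s' - ℓ a := by
      intro s' hs'
      obtain ⟨t, ht, ht'⟩ := mem_closure_iff_nhds.1 hs (Ioi s') (Ioi_mem_nhds hs'.2)
      exact ht'.1 s' ⟨hs'.1, le_of_lt ht⟩
    refine ⟨fun s' hs' => ?_, hsI⟩
    rcases hs'.2.lt_or_eq with h1 | rfl
    · exact hlt s' ⟨hs'.1, h1⟩
    · rcases hs'.1.eq_or_lt with h2 | h2
      · simp [← h2]
      · have hcl : s' ∈ closure (Ico a s') := by rw [closure_Ico h2.ne]; exact ⟨hs'.1, le_rfl⟩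
        have hsub : Ico a s' ⊆ Ico a b := fun x hx => hcI ⟨hx.1, hx.2.le.trans hsI.2⟩
        have := ContinuousWithinAt.closure_le hcl ((hφ s' (hcI hsI)).mono hsub)
          (continuousWithinAt_const (b := φ a + (ℓ s' - ℓ a))) fun y hy => by
            linarith [hlt y hy, hℓ (hsub hy) (hcI hsI) hy.2.le]
        linarith
  · intro s' hs'
    rw [Icc_self, mem_singleton_iff] at hs'
    simp [hs']
  · rintro x ⟨hxS, hx⟩ y hy
    obtain ⟨u, hu, hux⟩ := Metric.mem_nhdsWithin_iff.1 (h x (hcI ⟨hx.1, hx.2.le⟩))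
    have hz : x < min (min (x + u / 2) y) c := by
      refine lt_min (lt_min (by linarith) hy) hx.2
    refine ⟨min (min (x + u / 2) y) c, fun s' hs' => ?_, hz,
      (min_le_left _ _).trans (min_le_right _ _)⟩
    rcases le_total s' x with h1 | h1
    · exact hxS s' ⟨hs'.1, h1⟩
    · have h2 : s' ≤ x + u / 2 := hs'.2.trans ((min_le_left _ _).trans (min_le_left _ _))
      have h3 := hux ⟨?_, hcI ⟨hs'.1, hs'.2.trans (min_le_right _ _)⟩⟩ h1
      · linarith [hxS x ⟨hx.1, le_rfl⟩]
      · rw [Metric.mem_ball, Real.dist_eq, abs_of_nonneg (by linarith)]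
        linarith

/-- A Gronwall inequality along a path of finite length. -/
theorem exists_norm_le_of_boundedVariationOn {γ w : ℝ → ℂ} {a b C : ℝ} (hab : a < b)
    (hC : 0 ≤ C) (hbv : BoundedVariationOn γ (Icc a b)) (hw : ContinuousOn w (Ico a b))
    (h : ∀ s ∈ Ico a b, ∀ᶠ s' in 𝓝[Ico a b] s,
      ‖w s' - w s‖ ≤ C * (1 + ‖w s‖) * ‖γ s' - γ s‖) :
    ∃ B, ∀ s ∈ Ico a b, ‖w s‖ ≤ B := by
  have haI : a ∈ Icc a b := ⟨le_rfl, hab.le⟩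
  have hsub : Ico a b ⊆ Icc a b := Ico_subset_Icc_self
  have hlb := hbv.locallyBoundedVariationOn
  let v : ℝ → ℝ := variationOnFromTo γ (Icc a b) a
  have hvmono : MonotoneOn v (Icc a b) := variationOnFromTo.monotoneOn hlb haI
  have hdist : ∀ s ∈ Icc a b, ∀ s' ∈ Icc a b, s ≤ s' → ‖γ s' - γ s‖ ≤ v s' - v s := by
    intro s hs s' hs' hss
    have h1 : v s' - v s = variationOnFromTo γ (Icc a b) s s' := by
      have := variationOnFromTo.add hlb haI hs hs'
      simp only [v]
      linarith
    rw [h1, variationOnFromTo.eq_of_le _ _ hss, ← dist_eq_norm, dist_comm, dist_edist]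
    exact ENNReal.toReal_mono (hlb s s' hs hs')
      (eVariationOn.edist_le γ ⟨hs, le_rfl, hss⟩ ⟨hs', hss, le_rfl⟩)
  have key := sub_le_sub_of_local_growth (φ := fun s => Real.log (1 + ‖w s‖)) (ℓ := fun s => C * v s)
    (a := a) (b := b) ?_ ?_ ?_
  · refine ⟨Real.exp (Real.log (1 + ‖w a‖) + (C * v b - C * v a)), fun s hs => ?_⟩
    have h1 := key s hs
    have h2 : C * v s ≤ C * v b :=
      mul_le_mul_of_nonneg_left (hvmono (hsub hs) ⟨hab.le, le_rfl⟩ hs.2.le) hC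
    have h3 : 0 < 1 + ‖w s‖ := by positivity
    calc ‖w s‖ ≤ 1 + ‖w s‖ := by linarith
      _ = Real.exp (Real.log (1 + ‖w s‖)) := (Real.exp_log h3).symm
      _ ≤ _ := Real.exp_le_exp.2 (by linarith)
  · exact (continuousOn_const.add hw.norm).log fun s _ => (by positivity : (0 : ℝ) < 1 + ‖w s‖).ne'
  · exact fun s hs s' hs' hss => mul_le_mul_of_nonneg_left (hvmono (hsub hs) (hsub hs') hss) hC
  · intro s hs
    filter_upwards [h s hs, self_mem_nhdsWithin] with s' h1 hs' hss
    have hpos : 0 < 1 + ‖w s‖ := by positivity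
    have hpos' : 0 < 1 + ‖w s'‖ := by positivity
    have hstep : 1 + ‖w s'‖ ≤ (1 + ‖w s‖) * (1 + C * ‖γ s' - γ s‖) := by
      have := norm_le_insert' (w s') (w s)
      nlinarith
    have h2 : Real.log (1 + ‖w s'‖) ≤ Real.log (1 + ‖w s‖) + C * ‖γ s' - γ s‖ := by
      have hp : 0 < 1 + C * ‖γ s' - γ s‖ := by positivity
      calc Real.log (1 + ‖w s'‖) ≤ Real.log ((1 + ‖w s‖) * (1 + C * ‖γ s' - γ s‖)) :=
            Real.log_le_log hpos' hstep
        _ = Real.log (1 + ‖w s‖) + Real.log (1 + C * ‖γ s' - γ s‖) :=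
            Real.log_mul hpos.ne' hp.ne'
        _ ≤ _ := by linarith [Real.log_le_sub_one_of_pos hp]
    have h3 := mul_le_mul_of_nonneg_left (hdist s (hsub hs) s' (hsub hs') hss) hC
    linarith

/-! ### The modified energy -/

section Energy

variable {Ω : Set ℂ} {a b c : ℂ} {β δ : ℂ → ℂ}

/-- The equation under consideration: the quintic right-hand side for which both resonance
conditions hold, with `α(z) = a z + b` and `γ(z) = (a z + b)² / 16 + c`. -/
noncomputable abbrev resonantRHS (a b c : ℂ) (β δ : ℂ → ℂ) : ℂ → ℂ → ℂ :=
  quinticRHS (fun z => a * z + b) β (fun z => (a * z + b) ^ 2 / 16 + c) δ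

/-- The coefficient of `y` that is left in the derivative of the energy once the terms in `y⁴`,
`y³` and `y²` have been removed. -/
noncomputable def linearDefect (a : ℂ) (β δ : ℂ → ℂ) (z : ℂ) : ℂ :=
  a * β z / 12 - 2 * deriv δ z

/-- Twice the `y`-primitive of the right-hand side, as a function of `(z, y)`: for constant
coefficients `y'² - potential` is a first integral. -/
noncomputable def potential (a b c : ℂ) (β δ : ℂ → ℂ) (q : ℂ × ℂ) : ℂ :=
  q.2 ^ 6 + (a * q.1 + b) / 2 * q.2 ^ 4 + 2 / 3 * β q.1 * q.2 ^ 3 +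
    ((a * q.1 + b) ^ 2 / 16 + c) * q.2 ^ 2 + 2 * δ q.1 * q.2

/-- The coefficient of `y'` in the correction to the energy. -/
noncomputable def slopeCorrection (a : ℂ) (β δ : ℂ → ℂ) (q : ℂ × ℂ) : ℂ :=
  a / 4 / q.2 + 2 / 3 * deriv β q.1 / q.2 ^ 2 + linearDefect a β δ q.1 / q.2 ^ 4

/-- The part of the correction to the energy that does not involve `y'`. -/
noncomputable def constCorrection (β : ℂ → ℂ) (q : ℂ × ℂ) : ℂ :=
  2 / 3 * deriv (deriv β) q.1 / q.2

/-- The modified energy `W` as a function of `z`, `y` and `p = y'`. Its corrections are chosen such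
that its derivative along a solution is affine in `W` and `y' / y³` with coefficients that stay
bounded as `y → ∞`. -/
noncomputable def modifiedEnergy (a b c : ℂ) (β δ : ℂ → ℂ) (z y p : ℂ) : ℂ :=
  p ^ 2 + slopeCorrection a β δ (z, y) * p + (constCorrection β (z, y) - potential a b c β δ (z, y))

/-- `u² E` for the energy `E = y'² - potential`, in terms of `u = 1 / y`, the modified energy `W` and
`v = y' / y³`. -/
noncomputable def scaledEnergy (a : ℂ) (β δ : ℂ → ℂ) (z u W v : ℂ) : ℂ :=
  u ^ 2 * W - (a / 4 + 2 / 3 * deriv β z * u + linearDefect a β δ z * u ^ 3) * v -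
    2 / 3 * deriv (deriv β) z * u ^ 3

/-- `dW/dz` along a solution, in terms of `u = 1 / y`, `W` and `v = y' / y³`. -/
noncomputable def energyRate (a b c : ℂ) (β δ : ℂ → ℂ) (z u W v : ℂ) : ℂ :=
  -(a / 4) * (δ z * u + scaledEnergy a β δ z u W v) +
  2 / 3 * deriv β z * (-(β z / 3) - ((a * z + b) ^ 2 / 16 + c) * u - 3 * δ z * u ^ 2 -
    2 * u * scaledEnergy a β δ z u W v) +
  2 / 3 * deriv (deriv (deriv β)) z * u +
  linearDefect a β δ z * (-((a * z + b) * u) - 5 / 3 * β z * u ^ 2 -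
    3 * ((a * z + b) ^ 2 / 16 + c) * u ^ 3 - 7 * δ z * u ^ 4 -
    4 * u ^ 3 * scaledEnergy a β δ z u W v) +
  (a * deriv β z / 12 - 2 * deriv (deriv δ) z) * v * u

/-- `dv/dz` along a solution, in terms of `u = 1 / y`, `W` and `v = y' / y³`. -/
noncomputable def slopeRate (a b c : ℂ) (β δ : ℂ → ℂ) (z u W v : ℂ) : ℂ :=
  -((a * z + b) / 2) - β z * u - 2 * ((a * z + b) ^ 2 / 16 + c) * u ^ 2 - 5 * δ z * u ^ 3 -
    3 * u ^ 2 * scaledEnergy a β δ z u W v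

/-- The value of `v² - 1`, in terms of `u = 1 / y`, `W` and `v = y' / y³`. -/
noncomputable def slopeSqDefect (a b c : ℂ) (β δ : ℂ → ℂ) (z u W v : ℂ) : ℂ :=
  (a * z + b) / 2 * u ^ 2 + 2 / 3 * β z * u ^ 3 + ((a * z + b) ^ 2 / 16 + c) * u ^ 4 +
    2 * δ z * u ^ 5 + u ^ 4 * scaledEnergy a β δ z u W v

theorem scaledEnergy_eq (z p : ℂ) {y : ℂ} (hy : y ≠ 0) :
    scaledEnergy a β δ z (1 / y) (modifiedEnergy a b c β δ z y p) (p / y ^ 3) =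
      (p ^ 2 - potential a b c β δ (z, y)) / y ^ 2 := by
  simp only [scaledEnergy, modifiedEnergy, slopeCorrection, constCorrection]
  field_simp
  ring

theorem slope_sq_eq (z p : ℂ) {y : ℂ} (hy : y ≠ 0) :
    (p / y ^ 3) ^ 2 =
      1 + slopeSqDefect a b c β δ z (1 / y) (modifiedEnergy a b c β δ z y p) (p / y ^ 3) := by
  rw [slopeSqDefect, scaledEnergy_eq z p hy, potential]
  field_simp
  ring

/-- Along a solution `dv/dz` is polynomial in `u`, `W` and `v`: the terms of `y'' / y³ - 3 y'² / y⁴`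
that are singular at `u = 0` cancel by `slope_sq_eq`. -/
theorem hasDerivAt_slope {y p : ℂ → ℂ} {z : ℂ} (hy0 : y z ≠ 0) (hy : HasDerivAt y (p z) z)
    (hp : HasDerivAt p (resonantRHS a b c β δ z (y z)) z) :
    HasDerivAt (fun w => p w / y w ^ 3)
      (slopeRate a b c β δ z (1 / y z) (modifiedEnergy a b c β δ z (y z) (p z))
        (p z / y z ^ 3)) z := by
  have h := hp.div (hy.pow 3) (pow_ne_zero 3 hy0)
  refine h.congr_deriv ?_
  rw [slopeRate, scaledEnergy_eq z (p z) hy0, potential, resonantRHS, quinticRHS]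
  simp only [Pi.pow_apply]
  field_simp
  push_cast
  ring

/-- The two resonance conditions enter here: they remove the terms in `y²` from `dW/dz`. -/
theorem hasDerivAt_modifiedEnergy {y p : ℂ → ℂ} {z : ℂ} (hβ : AnalyticAt ℂ β z)
    (hδ : AnalyticAt ℂ δ z) (hy0 : y z ≠ 0) (hy : HasDerivAt y (p z) z)
    (hp : HasDerivAt p (resonantRHS a b c β δ z (y z)) z) :
    HasDerivAt (fun w => modifiedEnergy a b c β δ w (y w) (p w))
      (energyRate a b c β δ z (1 / y z) (modifiedEnergy a b c β δ z (y z) (p z))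
        (p z / y z ^ 3)) z := by
  have hβ0 := hβ.differentiableAt.hasDerivAt
  have hβ1 := hβ.deriv.differentiableAt.hasDerivAt
  have hβ2 := hβ.deriv.deriv.differentiableAt.hasDerivAt
  have hδ0 := hδ.differentiableAt.hasDerivAt
  have hδ1 := hδ.deriv.differentiableAt.hasDerivAt
  have hα : HasDerivAt (fun w => a * w + b) a z := by
    simpa using ((hasDerivAt_id z).const_mul a).add_const b
  have hκ : HasDerivAt (linearDefect a β δ) (a * deriv β z / 12 - 2 * deriv (deriv δ) z) z :=
    ((hβ0.const_mul a).div_const 12).sub (hδ1.const_mul 2)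
  have hslope : HasDerivAt (fun w => slopeCorrection a β δ (w, y w))
      (-(a / 4 * p z / y z ^ 2) + (2 / 3 * deriv (deriv β) z / y z ^ 2 -
        2 * (2 / 3 * deriv β z) * p z / y z ^ 3) +
        ((a * deriv β z / 12 - 2 * deriv (deriv δ) z) / y z ^ 4 -
        4 * linearDefect a β δ z * p z / y z ^ 5)) z := by
    have h := (((hasDerivAt_const z (a / 4)).div hy hy0).add
      ((hβ1.const_mul (2 / 3)).div (hy.pow 2) (pow_ne_zero 2 hy0))).add
      (hκ.div (hy.pow 4) (pow_ne_zero 4 hy0))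
    refine h.congr_deriv ?_
    simp only [Pi.pow_apply]
    field_simp
    push_cast
    ring
  have hconst : HasDerivAt (fun w => constCorrection β (w, y w))
      (2 / 3 * deriv (deriv (deriv β)) z / y z - 2 / 3 * deriv (deriv β) z * p z / y z ^ 2) z := by
    refine ((hβ2.const_mul (2 / 3)).div hy hy0).congr_deriv ?_
    field_simp
  have hpot : HasDerivAt (fun w => potential a b c β δ (w, y w))
      (2 * resonantRHS a b c β δ z (y z) * p z + a / 2 * y z ^ 4 + 2 / 3 * deriv β z * y z ^ 3 +
        a * (a * z + b) / 8 * y z ^ 2 + 2 * deriv δ z * y z) z := by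
    have h := ((((hy.pow 6).add ((hα.div_const 2).mul (hy.pow 4))).add
      ((hβ0.const_mul (2 / 3)).mul (hy.pow 3))).add
      ((((hα.pow 2).div_const 16).add_const c).mul (hy.pow 2))).add ((hδ0.const_mul 2).mul hy)
    refine h.congr_deriv ?_
    simp only [Pi.pow_apply, resonantRHS, quinticRHS]
    push_cast
    ring
  have h := ((hp.pow 2).add (hslope.mul hp)).add (hconst.sub hpot)
  refine h.congr_deriv ?_
  rw [energyRate, scaledEnergy_eq z (p z) hy0]
  simp only [slopeCorrection, potential, linearDefect, resonantRHS, quinticRHS]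
  field_simp
  push_cast
  ring

section Smooth

variable {E : Type*} [NormedAddCommGroup E] [NormedSpace ℂ E] {z u W v : E → ℂ} {x : E}

theorem contDiffAt_linearDefect (hβ : AnalyticOnNhd ℂ β Ω) (hδ : AnalyticOnNhd ℂ δ Ω)
    (hz : ContDiffAt ℂ 1 z x) (hzΩ : z x ∈ Ω) :
    ContDiffAt ℂ 1 (fun x => linearDefect a β δ (z x)) x := by
  have h1 : ContDiffAt ℂ 1 β (z x) := (hβ _ hzΩ).contDiffAt
  have h2 : ContDiffAt ℂ 1 (fun x => deriv δ (z x)) x := (hδ _ hzΩ).deriv.contDiffAt.comp x hz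
  unfold linearDefect
  fun_prop

theorem contDiffAt_scaledEnergy (hβ : AnalyticOnNhd ℂ β Ω) (hδ : AnalyticOnNhd ℂ δ Ω)
    (hz : ContDiffAt ℂ 1 z x) (hzΩ : z x ∈ Ω) (hu : ContDiffAt ℂ 1 u x) (hW : ContDiffAt ℂ 1 W x)
    (hv : ContDiffAt ℂ 1 v x) :
    ContDiffAt ℂ 1 (fun x => scaledEnergy a β δ (z x) (u x) (W x) (v x)) x := by
  have h1 : ContDiffAt ℂ 1 (fun x => deriv β (z x)) x := (hβ _ hzΩ).deriv.contDiffAt.comp x hz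
  have h2 : ContDiffAt ℂ 1 (fun x => deriv (deriv β) (z x)) x := (hβ _ hzΩ).deriv.deriv.contDiffAt.comp x hz
  have h3 := contDiffAt_linearDefect (a := a) hβ hδ hz hzΩ
  unfold scaledEnergy
  fun_prop

theorem contDiffAt_energyRate (hβ : AnalyticOnNhd ℂ β Ω) (hδ : AnalyticOnNhd ℂ δ Ω)
    (hz : ContDiffAt ℂ 1 z x) (hzΩ : z x ∈ Ω) (hu : ContDiffAt ℂ 1 u x) (hW : ContDiffAt ℂ 1 W x)
    (hv : ContDiffAt ℂ 1 v x) :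
    ContDiffAt ℂ 1 (fun x => energyRate a b c β δ (z x) (u x) (W x) (v x)) x := by
  have h0 : ContDiffAt ℂ 1 β (z x) := (hβ _ hzΩ).contDiffAt
  have h1 : ContDiffAt ℂ 1 (fun x => deriv β (z x)) x := (hβ _ hzΩ).deriv.contDiffAt.comp x hz
  have h2 : ContDiffAt ℂ 1 (fun x => deriv (deriv (deriv β)) (z x)) x :=
    (hβ _ hzΩ).deriv.deriv.deriv.contDiffAt.comp x hz
  have h3 : ContDiffAt ℂ 1 δ (z x) := (hδ _ hzΩ).contDiffAt
  have h4 : ContDiffAt ℂ 1 (fun x => deriv (deriv δ) (z x)) x := (hδ _ hzΩ).deriv.deriv.contDiffAt.comp x hz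
  have h5 := contDiffAt_linearDefect (a := a) hβ hδ hz hzΩ
  have h6 := contDiffAt_scaledEnergy (a := a) hβ hδ hz hzΩ hu hW hv
  unfold energyRate
  fun_prop

theorem contDiffAt_slopeRate (hβ : AnalyticOnNhd ℂ β Ω) (hδ : AnalyticOnNhd ℂ δ Ω)
    (hz : ContDiffAt ℂ 1 z x) (hzΩ : z x ∈ Ω) (hu : ContDiffAt ℂ 1 u x) (hW : ContDiffAt ℂ 1 W x)
    (hv : ContDiffAt ℂ 1 v x) :
    ContDiffAt ℂ 1 (fun x => slopeRate a b c β δ (z x) (u x) (W x) (v x)) x := by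
  have h0 : ContDiffAt ℂ 1 β (z x) := (hβ _ hzΩ).contDiffAt
  have h3 : ContDiffAt ℂ 1 δ (z x) := (hδ _ hzΩ).contDiffAt
  have h6 := contDiffAt_scaledEnergy (a := a) hβ hδ hz hzΩ hu hW hv
  unfold slopeRate
  fun_prop

theorem contDiffAt_slopeSqDefect (hβ : AnalyticOnNhd ℂ β Ω) (hδ : AnalyticOnNhd ℂ δ Ω)
    (hz : ContDiffAt ℂ 1 z x) (hzΩ : z x ∈ Ω) (hu : ContDiffAt ℂ 1 u x) (hW : ContDiffAt ℂ 1 W x)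
    (hv : ContDiffAt ℂ 1 v x) :
    ContDiffAt ℂ 1 (fun x => slopeSqDefect a b c β δ (z x) (u x) (W x) (v x)) x := by
  have h0 : ContDiffAt ℂ 1 β (z x) := (hβ _ hzΩ).contDiffAt
  have h3 : ContDiffAt ℂ 1 δ (z x) := (hδ _ hzΩ).contDiffAt
  have h6 := contDiffAt_scaledEnergy (a := a) hβ hδ hz hzΩ hu hW hv
  unfold slopeSqDefect
  fun_prop

theorem contDiffAt_resonantRHS (hβ : AnalyticOnNhd ℂ β Ω) (hδ : AnalyticOnNhd ℂ δ Ω)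
    (hz : ContDiffAt ℂ 1 z x) (hzΩ : z x ∈ Ω) (hu : ContDiffAt ℂ 1 u x) :
    ContDiffAt ℂ 1 (fun x => resonantRHS a b c β δ (z x) (u x)) x := by
  have h0 : ContDiffAt ℂ 1 β (z x) := (hβ _ hzΩ).contDiffAt
  have h3 : ContDiffAt ℂ 1 δ (z x) := (hδ _ hzΩ).contDiffAt
  unfold resonantRHS quinticRHS
  fun_prop

theorem contDiffAt_potential (hβ : AnalyticOnNhd ℂ β Ω) (hδ : AnalyticOnNhd ℂ δ Ω) {q : ℂ × ℂ}
    (hq : q.1 ∈ Ω) : ContDiffAt ℂ 1 (potential a b c β δ) q := by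
  have h0 : ContDiffAt ℂ 1 β q.1 := (hβ _ hq).contDiffAt
  have h3 : ContDiffAt ℂ 1 δ q.1 := (hδ _ hq).contDiffAt
  unfold potential
  fun_prop

theorem contDiffAt_slopeCorrection (hβ : AnalyticOnNhd ℂ β Ω) (hδ : AnalyticOnNhd ℂ δ Ω)
    {q : ℂ × ℂ} (hq : q.1 ∈ Ω) (hq2 : q.2 ≠ 0) : ContDiffAt ℂ 1 (slopeCorrection a β δ) q := by
  have h0 : ContDiffAt ℂ 1 (fun x : ℂ × ℂ => deriv β x.1) q := (hβ _ hq).deriv.contDiffAt.comp q contDiffAt_fst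
  have h3 := contDiffAt_linearDefect (a := a) hβ hδ contDiffAt_fst hq
  unfold slopeCorrection
  fun_prop (disch := simpa using hq2)

theorem contDiffAt_constCorrection (hβ : AnalyticOnNhd ℂ β Ω)
    {q : ℂ × ℂ} (hq : q.1 ∈ Ω) (hq2 : q.2 ≠ 0) : ContDiffAt ℂ 1 (constCorrection β) q := by
  have h0 : ContDiffAt ℂ 1 (fun x : ℂ × ℂ => deriv (deriv β) x.1) q :=
    (hβ _ hq).deriv.deriv.contDiffAt.comp q contDiffAt_fst
  unfold constCorrection
  fun_prop (disch := simpa using hq2)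

end Smooth

end Energy

/-! ### Growth of the energy along solutions -/

section Growth

variable {Ω : Set ℂ} {a b c : ℂ} {β δ : ℂ → ℂ}

/-- A smooth function equal to `0` for `‖y‖ ≤ 1` and to `1` for `‖y‖ ≥ 2`. -/
noncomputable def cutoff (y : ℂ) : ℝ :=
  1 - (⟨1, 2, one_pos, one_lt_two⟩ : ContDiffBump (0 : ℂ)) y

theorem cutoff_eq_one {y : ℂ} (hy : 2 ≤ ‖y‖) : cutoff y = 1 := by
  rw [cutoff, ContDiffBump.zero_of_le_dist _ (by simpa using hy), sub_zero]

theorem contDiff_cutoff : ContDiff ℝ 1 cutoff :=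
  contDiff_const.sub (ContDiffBump.contDiff _)

/-- Multiplying by the cutoff removes a singularity at `y = 0`. -/
theorem contDiffAt_cutoff_mul {g : ℂ × ℂ → ℂ} {q : ℂ × ℂ} (hg : q.2 ≠ 0 → ContDiffAt ℂ 1 g q) :
    ContDiffAt ℝ 1 (fun q : ℂ × ℂ => (cutoff q.2 : ℂ) * g q) q := by
  by_cases h : q.2 = 0
  · have hev : ∀ᶠ x in 𝓝 q, ‖x.2‖ < 1 := by
      refine continuousAt_snd.norm.eventually (gt_mem_nhds ?_)
      simp [h]
    refine (contDiffAt_const (c := (0 : ℂ))).congr_of_eventuallyEq ?_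
    filter_upwards [hev] with x hx
    have : cutoff x.2 = 0 := by
      rw [cutoff, ContDiffBump.one_of_mem_closedBall _ (by simpa using hx.le), sub_self]
    simp [this]
  · have h1 : ContDiffAt ℝ 1 (fun q : ℂ × ℂ => (cutoff q.2 : ℂ)) q :=
      Complex.ofRealCLM.contDiff.contDiffAt.comp q
        (contDiff_cutoff.contDiffAt.comp q contDiffAt_snd)
    exact h1.mul ((hg h).restrict_scalars ℝ)

/-- The modified energy with its corrections cut off near `y = 0`. It is only real differentiable,
but defined for all `y`, so that it can be followed along a path on which `y` may vanish. -/
noncomputable def cutoffEnergy (a b c : ℂ) (β δ : ℂ → ℂ) (z y p : ℂ) : ℂ :=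
  p ^ 2 + (cutoff y * slopeCorrection a β δ (z, y)) * p +
    (cutoff y * constCorrection β (z, y) - potential a b c β δ (z, y))

theorem cutoffEnergy_eq {z y p : ℂ} (hy : 2 ≤ ‖y‖) :
    cutoffEnergy a b c β δ z y p = modifiedEnergy a b c β δ z y p := by
  simp [cutoffEnergy, modifiedEnergy, cutoff_eq_one hy]

theorem sq_norm_le_of_quadratic {p A B : ℂ} {M : ℝ} (hA : ‖A‖ ≤ M) (hB : ‖B‖ ≤ M) :
    ‖p‖ ^ 2 ≤ 2 * ‖p ^ 2 + A * p + B‖ + M ^ 2 + 2 * M := by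
  have h1 : ‖p‖ ^ 2 ≤ ‖p ^ 2 + A * p + B‖ + ‖A‖ * ‖p‖ + ‖B‖ := by
    calc ‖p‖ ^ 2 = ‖(p ^ 2 + A * p + B) - A * p - B‖ := by rw [← norm_pow]; congr 1; ring
      _ ≤ ‖(p ^ 2 + A * p + B) - A * p‖ + ‖B‖ := norm_sub_le _ _
      _ ≤ ‖p ^ 2 + A * p + B‖ + ‖A * p‖ + ‖B‖ := by gcongr; exact norm_sub_le _ _
      _ = _ := by rw [norm_mul]
  nlinarith [sq_nonneg (‖p‖ - M), norm_nonneg p, mul_le_mul_of_nonneg_right hA (norm_nonneg p)]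

theorem eventually_norm_sub_le_of_hasFDerivAt {w : ℂ → ℂ} {L : ℂ →L[ℝ] ℂ} {z₀ : ℂ} {C : ℝ}
    (hw : HasFDerivAt w L z₀) (hL : ∀ h, ‖L h‖ ≤ C * ‖h‖) :
    ∀ᶠ z in 𝓝 z₀, ‖w z - w z₀‖ ≤ (C + 1) * ‖z - z₀‖ := by
  filter_upwards [hw.isLittleO.def one_pos] with z hz
  calc ‖w z - w z₀‖ = ‖(w z - w z₀ - L (z - z₀)) + L (z - z₀)‖ := by rw [sub_add_cancel]
    _ ≤ 1 * ‖z - z₀‖ + C * ‖z - z₀‖ := (norm_add_le _ _).trans (add_le_add hz (hL _))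
    _ = _ := by ring

/-- While `(z, y)` stays in a compact set, any energy that is monic quadratic in `p = y'`, with real
`C¹` coefficients in `(z, y)`, grows at most exponentially in the arc length: it is bounded below by
a multiple of `‖p‖²`, and its derivative is bounded above by such a multiple, up to constants. -/
theorem exists_growth_bound_of_isCompact {A B P : ℂ × ℂ → ℂ} {K : Set (ℂ × ℂ)} (hK : IsCompact K)
    (hA : ∀ q ∈ K, ContDiffAt ℝ 1 A q) (hB : ∀ q ∈ K, ContDiffAt ℝ 1 B q)
    (hP : ContinuousOn P K) :
    ∃ C : ℝ, 0 ≤ C ∧ ∀ (z₀ : ℂ) (y p : ℂ → ℂ), (z₀, y z₀) ∈ K → HasDerivAt y (p z₀) z₀ →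
      HasDerivAt p (P (z₀, y z₀)) z₀ → ∀ᶠ z in 𝓝 z₀,
        ‖(p z ^ 2 + A (z, y z) * p z + B (z, y z)) -
            (p z₀ ^ 2 + A (z₀, y z₀) * p z₀ + B (z₀, y z₀))‖ ≤
          C * (1 + ‖p z₀ ^ 2 + A (z₀, y z₀) * p z₀ + B (z₀, y z₀)‖) * ‖z - z₀‖ := by
  have cd : ∀ F : ℂ × ℂ → ℂ, (∀ q ∈ K, ContDiffAt ℝ 1 F q) → ContinuousOn (fderiv ℝ F) K :=
    fun F hF q hq => ((hF q hq).continuousAt_fderiv (by norm_num)).continuousWithinAt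
  obtain ⟨M₁, h₁⟩ := hK.exists_bound_of_continuousOn
    (fun q hq => (hA q hq).continuousAt.continuousWithinAt)
  obtain ⟨M₂, h₂⟩ := hK.exists_bound_of_continuousOn
    (fun q hq => (hB q hq).continuousAt.continuousWithinAt)
  obtain ⟨M₃, h₃⟩ := hK.exists_bound_of_continuousOn (cd A hA)
  obtain ⟨M₄, h₄⟩ := hK.exists_bound_of_continuousOn (cd B hB)
  obtain ⟨M₅, h₅⟩ := hK.exists_bound_of_continuousOn hP
  obtain ⟨M, hM1, hM₁, hM₂, hM₃, hM₄, hM₅⟩ : ∃ M : ℝ, 1 ≤ M ∧ M₁ ≤ M ∧ M₂ ≤ M ∧ M₃ ≤ M ∧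
      M₄ ≤ M ∧ M₅ ≤ M :=
    ⟨max 1 (max M₁ (max M₂ (max M₃ (max M₄ M₅)))), by simp, by simp, by simp, by simp, by simp,
      by simp⟩
  refine ⟨20 * M ^ 4, by positivity, fun z₀ y p hq hy hp => ?_⟩
  set q : ℂ × ℂ := (z₀, y z₀) with hqdef
  set x : ℝ := ‖p z₀‖ with hx
  have hx0 : 0 ≤ x := norm_nonneg _
  set Ly : ℂ →L[ℝ] ℂ := (ContinuousLinearMap.toSpanSingleton ℂ (p z₀)).restrictScalars ℝ
  set Lp : ℂ →L[ℝ] ℂ := (ContinuousLinearMap.toSpanSingleton ℂ (P q)).restrictScalars ℝ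
  have hyR : HasFDerivAt y Ly z₀ := hy.hasFDerivAt.restrictScalars ℝ
  have hpR : HasFDerivAt p Lp z₀ := hp.hasFDerivAt.restrictScalars ℝ
  have hzy : HasFDerivAt (fun z => (z, y z)) ((ContinuousLinearMap.id ℝ ℂ).prod Ly) z₀ :=
    (hasFDerivAt_id z₀).prodMk hyR
  have hAR := ((hA q hq).differentiableAt one_ne_zero).hasFDerivAt.comp z₀ hzy
  have hBR := ((hB q hq).differentiableAt one_ne_zero).hasFDerivAt.comp z₀ hzy
  have hw := ((hpR.pow 2).add (hAR.mul hpR)).add hBR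
  have hL : ∀ h : ℂ, ‖(2 * p z₀ * (P q * h) + (A q * (P q * h) +
      fderiv ℝ A q (h, p z₀ * h) * p z₀) + fderiv ℝ B q (h, p z₀ * h))‖ ≤
      (4 * M ^ 2 * (1 + x ^ 2)) * ‖h‖ := by
    intro h
    have e1 : ‖((h, p z₀ * h) : ℂ × ℂ)‖ ≤ (1 + x) * ‖h‖ := by
      rw [Prod.norm_def, norm_mul]
      refine max_le ?_ ?_ <;> nlinarith [norm_nonneg h, mul_nonneg hx0 (norm_nonneg h)]
    have e2 : ∀ F : ℂ × ℂ → ℂ, ‖fderiv ℝ F q‖ ≤ M →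
        ‖fderiv ℝ F q (h, p z₀ * h)‖ ≤ M * ((1 + x) * ‖h‖) := fun F hF =>
      ((fderiv ℝ F q).le_opNorm _).trans (by gcongr)
    have e3 := e2 A ((h₃ q hq).trans hM₃)
    have e4 := e2 B ((h₄ q hq).trans hM₄)
    have e5 : ‖P q‖ ≤ M := (h₅ q hq).trans hM₅
    have e6 : ‖A q‖ ≤ M := (h₁ q hq).trans hM₁
    calc _ ≤ 2 * x * (M * ‖h‖) + (M * (M * ‖h‖) + M * ((1 + x) * ‖h‖) * x) +
          M * ((1 + x) * ‖h‖) := by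
          refine (norm_add_le _ _).trans (add_le_add ((norm_add_le _ _).trans (add_le_add ?_
            ((norm_add_le _ _).trans (add_le_add ?_ ?_)))) e4)
          · rw [norm_mul, norm_mul, norm_mul, Complex.norm_two]
            gcongr
          · rw [norm_mul, norm_mul]
            gcongr
          · rw [norm_mul]
            gcongr
      _ = (2 * x * M + M ^ 2 + M * (1 + x) * x + M * (1 + x)) * ‖h‖ := by ring
      _ ≤ _ := by
          gcongr
          nlinarith [sq_nonneg (x - 1), mul_nonneg (sub_nonneg.2 hM1) (sq_nonneg x),
            mul_nonneg (sub_nonneg.2 hM1) (sq_nonneg (x - 1)),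
            mul_nonneg (mul_nonneg (zero_le_one.trans hM1) (sub_nonneg.2 hM1)) (sq_nonneg x),
            mul_nonneg (zero_le_one.trans hM1) (sub_nonneg.2 hM1)]
  have hfin := eventually_norm_sub_le_of_hasFDerivAt hw (C := 4 * M ^ 2 * (1 + x ^ 2)) fun h => by
    refine le_of_eq_of_le ?_ (hL h)
    congr 1
    simp [Ly, Lp, ← hqdef]
    ring_nf
  have hsq := sq_norm_le_of_quadratic (p := p z₀) ((h₁ q hq).trans hM₁) ((h₂ q hq).trans hM₂)
  filter_upwards [hfin] with z hz
  refine le_trans (by simpa using hz) ?_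
  gcongr
  set ω : ℝ := ‖p z₀ ^ 2 + A q * p z₀ + B q‖
  have hω : 0 ≤ ω := norm_nonneg _
  have hM2 : 1 ≤ M ^ 2 := one_le_pow₀ hM1
  have h6 : 1 + x ^ 2 ≤ 4 * M ^ 2 * (1 + ω) := by nlinarith
  calc 4 * M ^ 2 * (1 + x ^ 2) + 1 ≤ 5 * M ^ 2 * (1 + x ^ 2) := by nlinarith [sq_nonneg x]
    _ ≤ 5 * M ^ 2 * (4 * M ^ 2 * (1 + ω)) := by gcongr
    _ = _ := by ring

theorem exists_affine_bound {G : ℂ → ℂ → ℂ → ℂ → ℂ} {K : Set ℂ} (hK : IsCompact K)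
    (hc : ∀ W v, ContinuousOn (fun q : ℂ × ℂ => G q.1 q.2 W v) (K ×ˢ Metric.closedBall 0 1))
    (haff : ∀ z u W v, G z u W v =
      G z u 0 0 + (G z u 1 0 - G z u 0 0) * W + (G z u 0 1 - G z u 0 0) * v) :
    ∃ M : ℝ, 0 < M ∧ ∀ z ∈ K, ∀ u, ‖u‖ ≤ 1 → ∀ W v, ‖G z u W v‖ ≤ M * (1 + ‖W‖ + ‖v‖) := by
  have hKc : IsCompact (K ×ˢ Metric.closedBall (0 : ℂ) 1) := hK.prod (isCompact_closedBall _ _)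
  obtain ⟨M₁, h₁⟩ := hKc.exists_bound_of_continuousOn (hc 0 0)
  obtain ⟨M₂, h₂⟩ := hKc.exists_bound_of_continuousOn ((hc 1 0).sub (hc 0 0))
  obtain ⟨M₃, h₃⟩ := hKc.exists_bound_of_continuousOn ((hc 0 1).sub (hc 0 0))
  refine ⟨max 1 (max M₁ (max M₂ M₃)), by positivity, fun z hz u hu W v => ?_⟩
  have hq : (z, u) ∈ K ×ˢ Metric.closedBall (0 : ℂ) 1 := ⟨hz, by simpa using hu⟩
  set M := max 1 (max M₁ (max M₂ M₃))
  have e1 : ‖G z u 0 0‖ ≤ M := (h₁ _ hq).trans (by simp [M])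
  have e2 : ‖G z u 1 0 - G z u 0 0‖ ≤ M := (h₂ _ hq).trans (by simp [M])
  have e3 : ‖G z u 0 1 - G z u 0 0‖ ≤ M := (h₃ _ hq).trans (by simp [M])
  rw [haff]
  calc _ ≤ ‖G z u 0 0‖ + ‖(G z u 1 0 - G z u 0 0) * W‖ + ‖(G z u 0 1 - G z u 0 0) * v‖ :=
        norm_add₃_le
    _ ≤ M + M * ‖W‖ + M * ‖v‖ := by
        rw [norm_mul, norm_mul]
        gcongr
    _ = _ := by ring

/-- `v = y' / y³` is controlled by the modified energy for large `y`. -/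
theorem exists_norm_slope_le (hβ : AnalyticOnNhd ℂ β Ω) (hδ : AnalyticOnNhd ℂ δ Ω) {K : Set ℂ}
    (hK : IsCompact K) (hKΩ : K ⊆ Ω) :
    ∃ M : ℝ, 0 < M ∧ ∀ z ∈ K, ∀ y p : ℂ, 1 ≤ ‖y‖ →
      ‖p / y ^ 3‖ ≤ M * (1 + ‖modifiedEnergy a b c β δ z y p‖) := by
  obtain ⟨M, hM, h⟩ := exists_affine_bound (G := slopeSqDefect a b c β δ) hK
    (fun W v q hq => (contDiffAt_slopeSqDefect hβ hδ contDiffAt_fst (hKΩ hq.1) contDiffAt_snd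
      contDiffAt_const contDiffAt_const).continuousAt.continuousWithinAt)
    (fun z u W v => by simp only [slopeSqDefect, scaledEnergy]; ring)
  refine ⟨M ^ 2 + 2 * M + 3, by positivity, fun z hz y p hy => ?_⟩
  have hy0 : y ≠ 0 := norm_pos_iff.1 (one_pos.trans_le hy)
  have hu : ‖1 / y‖ ≤ 1 := by
    rw [norm_div, norm_one]
    exact div_le_one_of_le₀ hy (norm_nonneg _)
  have h1 := slope_sq_eq (a := a) (b := b) (c := c) (β := β) (δ := δ) z p hy0
  have h2 := h z hz (1 / y) hu (modifiedEnergy a b c β δ z y p) (p / y ^ 3)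
  set v := p / y ^ 3
  set W := modifiedEnergy a b c β δ z y p
  have h3 : ‖v‖ ^ 2 ≤ 1 + M * (1 + ‖W‖ + ‖v‖) := by
    rw [← norm_pow, h1]
    exact (norm_add_le _ _).trans (by rw [norm_one]; gcongr)
  nlinarith [norm_nonneg W, norm_nonneg v, sq_nonneg (‖v‖ - M), sq_nonneg (‖v‖ - 1),
    mul_nonneg (sq_nonneg M) (norm_nonneg W)]

/-- Along any solution, the modified energy grows at most exponentially in the arc length. -/
theorem exists_energy_growth_bound (hβ : AnalyticOnNhd ℂ β Ω) (hδ : AnalyticOnNhd ℂ δ Ω)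
    {K : Set ℂ} (hK : IsCompact K) (hKΩ : K ⊆ Ω) :
    ∃ C : ℝ, 0 ≤ C ∧ ∀ z₀ ∈ K, ∀ y p : ℂ → ℂ, HasDerivAt y (p z₀) z₀ →
      HasDerivAt p (resonantRHS a b c β δ z₀ (y z₀)) z₀ → ∀ᶠ z in 𝓝 z₀,
        ‖cutoffEnergy a b c β δ z (y z) (p z) - cutoffEnergy a b c β δ z₀ (y z₀) (p z₀)‖ ≤
          C * (1 + ‖cutoffEnergy a b c β δ z₀ (y z₀) (p z₀)‖) * ‖z - z₀‖ := by
  obtain ⟨C₁, hC₁, h₁⟩ := exists_growth_bound_of_isCompact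
    (A := fun q => cutoff q.2 * slopeCorrection a β δ q)
    (B := fun q => cutoff q.2 * constCorrection β q - potential a b c β δ q)
    (P := fun q => resonantRHS a b c β δ q.1 q.2)
    (hK.prod (isCompact_closedBall (0 : ℂ) 3))
    (fun q hq => contDiffAt_cutoff_mul (contDiffAt_slopeCorrection hβ hδ (hKΩ hq.1)))
    (fun q hq => (contDiffAt_cutoff_mul (contDiffAt_constCorrection hβ (hKΩ hq.1))).sub
      ((contDiffAt_potential hβ hδ (hKΩ hq.1)).restrict_scalars ℝ))
    (fun q hq => (contDiffAt_resonantRHS hβ hδ contDiffAt_fst (hKΩ hq.1)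
      contDiffAt_snd).continuousAt.continuousWithinAt)
  obtain ⟨M, hM, hMs⟩ := exists_norm_slope_le (a := a) (b := b) (c := c) hβ hδ hK hKΩ
  obtain ⟨R, hR, hRs⟩ := exists_affine_bound (G := energyRate a b c β δ) hK
    (fun W v q hq => (contDiffAt_energyRate hβ hδ contDiffAt_fst (hKΩ hq.1) contDiffAt_snd
      contDiffAt_const contDiffAt_const).continuousAt.continuousWithinAt)
    (fun z u W v => by simp only [energyRate, scaledEnergy]; ring)
  refine ⟨max C₁ (R * (1 + M) + 1), le_max_of_le_left hC₁, fun z₀ hz₀ y p hy hp => ?_⟩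
  by_cases hy3 : ‖y z₀‖ ≤ 3
  · filter_upwards [h₁ z₀ y p ⟨hz₀, by simpa using hy3⟩ hy hp] with z hz
    refine hz.trans ?_
    have := le_max_left C₁ (R * (1 + M) + 1)
    simp only [cutoffEnergy]
    gcongr
  · have hy2 : 2 < ‖y z₀‖ := by linarith
    have hy0 : y z₀ ≠ 0 := norm_pos_iff.1 (by linarith)
    have hev : ∀ᶠ z in 𝓝 z₀, 2 < ‖y z‖ := hy.continuousAt.norm.eventually (lt_mem_nhds hy2)
    have hd := hasDerivAt_modifiedEnergy (hβ _ (hKΩ hz₀)) (hδ _ (hKΩ hz₀)) hy0 hy hp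
    set W := modifiedEnergy a b c β δ z₀ (y z₀) (p z₀) with hW
    have hu : ‖1 / y z₀‖ ≤ 1 := by
      rw [norm_div, norm_one]
      exact div_le_one_of_le₀ (by linarith) (norm_nonneg _)
    have hrate : ‖energyRate a b c β δ z₀ (1 / y z₀) W (p z₀ / y z₀ ^ 3)‖ ≤
        R * (1 + M) * (1 + ‖W‖) := by
      refine (hRs z₀ hz₀ _ hu W _).trans ?_
      have := hMs z₀ hz₀ (y z₀) (p z₀) (by linarith)
      rw [← hW] at this
      calc R * (1 + ‖W‖ + ‖p z₀ / y z₀ ^ 3‖) ≤ R * (1 + ‖W‖ + M * (1 + ‖W‖)) := by gcongr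
        _ = _ := by ring
    have hfin := eventually_norm_sub_le_of_hasFDerivAt (hd.hasFDerivAt.restrictScalars ℝ)
      (C := R * (1 + M) * (1 + ‖W‖)) fun h => by
        simp only [ContinuousLinearMap.coe_restrictScalars',
          ContinuousLinearMap.toSpanSingleton_apply, smul_eq_mul, norm_mul]
        rw [mul_comm]
        gcongr
    filter_upwards [hev, hfin] with z hz2 hz
    rw [cutoffEnergy_eq hy2.le, cutoffEnergy_eq hz2.le, ← hW]
    refine hz.trans ?_
    gcongr
    have h1 := le_max_right C₁ (R * (1 + M) + 1)
    nlinarith [norm_nonneg W, mul_le_mul_of_nonneg_right h1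
      (by positivity : (0 : ℝ) ≤ 1 + ‖W‖)]

end Growth

/-! ### The solution near the end of the path -/

theorem exists_forall_Ico_of_eventually {P : ℝ → Prop} {a b : ℝ} (hab : a < b)
    (h : ∀ᶠ s in 𝓝[<] b, P s) : ∃ s₀ ∈ Ico a b, ∀ s ∈ Ico s₀ b, P s := by
  obtain ⟨l, hl, hsub⟩ := mem_nhdsLT_iff_exists_Ico_subset.1 h
  exact ⟨max l a, ⟨le_max_right _ _, max_lt hl hab⟩, fun s hs =>
    hsub ⟨(le_max_left _ _).trans hs.1, hs.2⟩⟩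

theorem eventually_nhdsLT_of_forall_Ico {P : ℝ → Prop} {a b : ℝ} (hab : a < b)
    (h : ∀ s ∈ Ico a b, P s) : ∀ᶠ s in 𝓝[<] b, P s :=
  mem_of_superset (Ico_mem_nhdsLT hab) h

theorem Filter.Tendsto.mapClusterPt_prodMk {ι X Y : Type*} [TopologicalSpace X]
    [TopologicalSpace Y] {l : Filter ι} {f : ι → X} {g : ι → Y} {x : X} {y : Y}
    (hf : Tendsto f l (𝓝 x)) (hg : MapClusterPt y l g) :
    MapClusterPt (x, y) l fun i => (f i, g i) := by
  rw [mapClusterPt_iff_frequently]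
  intro U hU
  rw [nhds_prod_eq] at hU
  obtain ⟨A, hA, B, hB, hAB⟩ := mem_prod_iff.1 hU
  exact ((hg.frequently hB).and_eventually (hf.eventually hA)).mono fun i hi => hAB ⟨hi.2, hi.1⟩

section Path

variable {Ω : Set ℂ} {a b c : ℂ} {β δ : ℂ → ℂ} {γ : ℝ → ℂ} {F : ℝ → ℂ → ℂ}

theorem IsAnalyticContinuationAlong.eventually_eq (hF : IsAnalyticContinuationAlong γ F) {s : ℝ}
    (hs : s ∈ Ico (0 : ℝ) 1) : ∀ᶠ s' in 𝓝[Ico (0 : ℝ) 1] s,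
      F s' (γ s') = F s (γ s') ∧ deriv (F s') (γ s') = deriv (F s) (γ s') := by
  filter_upwards [hF.compatible s hs] with s' h
  exact ⟨h.self_of_nhds, h.deriv_eq⟩

theorem IsAnalyticContinuationAlong.continuousOn_jet (hF : IsAnalyticContinuationAlong γ F)
    (hγ : ContinuousOn γ (Ico 0 1)) :
    ContinuousOn (fun s => (F s (γ s), deriv (F s) (γ s))) (Ico 0 1) := by
  intro s hs
  have h1 : ContinuousAt (fun z => (F s z, deriv (F s) z)) (γ s) :=
    (hF.analyticAt s hs).continuousAt.prodMk (hF.analyticAt s hs).deriv.continuousAt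
  refine (h1.comp_continuousWithinAt (hγ s hs)).congr_of_eventuallyEq ?_ rfl
  filter_upwards [hF.eventually_eq hs] with s' h
  simp [h.1, h.2]

/-- The function elements obtained by continuation still solve the equation. -/
theorem ReachesMovableSingularity.solution_of_mem (hβ : AnalyticOnNhd ℂ β Ω)
    (hδ : AnalyticOnNhd ℂ δ Ω)
    (H : ReachesMovableSingularity Ω (resonantRHS a b c β δ) γ F) {s : ℝ}
    (hs : s ∈ Ico (0 : ℝ) 1) :
    ∀ᶠ z in 𝓝 (γ s), HasDerivAt (F s) (deriv (F s) z) z ∧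
      HasDerivAt (deriv (F s)) (resonantRHS a b c β δ z (F s z)) z := by
  have han := H.continuation.analyticAt
  have key := eventuallyEq_zero_of_continuation
    (G := fun s z => deriv (deriv (F s)) z - resonantRHS a b c β δ z (F s z))
    (H.continuousOn.mono Ico_subset_Icc_self) ?_ ?_ ?_ s hs
  · filter_upwards [key, (han s hs).eventually_analyticAt] with z h1 h2
    have h3 : deriv (deriv (F s)) z - resonantRHS a b c β δ z (F s z) = 0 := h1
    refine ⟨h2.differentiableAt.hasDerivAt, ?_⟩
    rw [← sub_eq_zero.1 h3]
    exact h2.deriv.differentiableAt.hasDerivAt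
  · intro s hs
    have hsΩ := H.mapsTo (Ico_subset_Icc_self hs)
    have e0 := han s hs
    have e1 : AnalyticAt ℂ β (γ s) := hβ _ hsΩ
    have e2 : AnalyticAt ℂ δ (γ s) := hδ _ hsΩ
    have e3 : AnalyticAt ℂ (fun z : ℂ => a * z + b) (γ s) :=
      (analyticAt_const.mul analyticAt_id).add analyticAt_const
    simp only [resonantRHS, quinticRHS]
    exact e0.deriv.deriv.sub (((((analyticAt_const.mul (e0.pow 5)).add (e3.mul (e0.pow 3))).add
      (e1.mul (e0.pow 2))).add ((((e3.pow 2).div analyticAt_const (by norm_num)).add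
        analyticAt_const).mul e0)).add e2)
  · intro s hs
    filter_upwards [H.continuation.compatible s hs] with s' h
    filter_upwards [h, h.deriv.deriv] with z h1 h2
    rw [h1, h2]
  · filter_upwards [H.solution] with z hz
    simp [hz]

theorem ReachesMovableSingularity.tendsto_path
    (H : ReachesMovableSingularity Ω (resonantRHS a b c β δ) γ F) :
    Tendsto γ (𝓝[<] 1) (𝓝 (γ 1)) := by
  have := H.continuousOn 1 ⟨zero_le_one, le_rfl⟩
  rw [ContinuousWithinAt, nhdsWithin_Icc_eq_nhdsLE zero_lt_one] at this
  exact this.mono_left (nhdsWithin_mono _ Iio_subset_Iic_self)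

/-- The energy stays bounded towards the end of the path. -/
theorem ReachesMovableSingularity.exists_energy_bound (hβ : AnalyticOnNhd ℂ β Ω)
    (hδ : AnalyticOnNhd ℂ δ Ω)
    (H : ReachesMovableSingularity Ω (resonantRHS a b c β δ) γ F) {K : Set ℂ} (hK : IsCompact K)
    (hKΩ : K ⊆ Ω) (hKn : K ∈ 𝓝 (γ 1)) :
    ∃ B : ℝ, ∀ᶠ s in 𝓝[<] (1 : ℝ),
      ‖cutoffEnergy a b c β δ (γ s) (F s (γ s)) (deriv (F s) (γ s))‖ ≤ B := by
  obtain ⟨C, hC, hgrow⟩ := exists_energy_growth_bound (a := a) (b := b) (c := c) hβ hδ hK hKΩ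
  obtain ⟨s₁, hs₁, hs₁K⟩ := exists_forall_Ico_of_eventually zero_lt_one
    (H.tendsto_path.eventually hKn)
  have hsub : Ico s₁ 1 ⊆ Ico 0 1 := Ico_subset_Ico_left hs₁.1
  have hloc : ∀ s ∈ Ico s₁ 1, ∀ᶠ z in 𝓝 (γ s),
      ‖cutoffEnergy a b c β δ z (F s z) (deriv (F s) z) -
        cutoffEnergy a b c β δ (γ s) (F s (γ s)) (deriv (F s) (γ s))‖ ≤
      C * (1 + ‖cutoffEnergy a b c β δ (γ s) (F s (γ s)) (deriv (F s) (γ s))‖) *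
        ‖z - γ s‖ := by
    intro s hs
    have h := (H.solution_of_mem hβ hδ (hsub hs)).self_of_nhds
    exact hgrow (γ s) (hs₁K s hs) (F s) (deriv (F s)) h.1 h.2
  set w : ℝ → ℂ := fun s => cutoffEnergy a b c β δ (γ s) (F s (γ s)) (deriv (F s) (γ s)) with hw
  have hγ : ∀ s ∈ Ico s₁ 1, ContinuousWithinAt γ (Ico s₁ 1) s := fun s hs =>
    (H.continuousOn s (Ico_subset_Icc_self (hsub hs))).mono (hsub.trans Ico_subset_Icc_self)
  have hstep : ∀ s ∈ Ico s₁ 1, ∀ᶠ s' in 𝓝[Ico s₁ 1] s,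
      ‖w s' - w s‖ ≤ C * (1 + ‖w s‖) * ‖γ s' - γ s‖ := by
    intro s hs
    filter_upwards [(hγ s hs).eventually (hloc s hs),
      nhdsWithin_mono _ hsub (H.continuation.eventually_eq (hsub hs))] with s' h1 h2
    simp only [hw]
    rw [h2.1, h2.2]
    exact h1
  have hcont : ContinuousOn w (Ico s₁ 1) := by
    intro s hs
    have h1 : Tendsto (fun s' => C * (1 + ‖w s‖) * ‖γ s' - γ s‖) (𝓝[Ico s₁ 1] s) (𝓝 0) := by
      have := (((hγ s hs).sub_const (γ s)).norm).const_mul (C * (1 + ‖w s‖))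
      simpa using this
    rw [ContinuousWithinAt, tendsto_iff_norm_sub_tendsto_zero]
    exact squeeze_zero' (Eventually.of_forall fun _ => norm_nonneg _) (hstep s hs) h1
  obtain ⟨B, hB⟩ := exists_norm_le_of_boundedVariationOn hs₁.2 hC
    (H.finite_length.mono (Icc_subset_Icc_left hs₁.1)) hcont hstep
  exact ⟨B, eventually_nhdsLT_of_forall_Ico hs₁.2 hB⟩

/-- By the uniform local existence theorem, a singularity is reached only if `(y, y')` leaves every
compact set. -/
theorem ReachesMovableSingularity.eventually_not_bounded (hβ : AnalyticOnNhd ℂ β Ω)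
    (hδ : AnalyticOnNhd ℂ δ Ω)
    (H : ReachesMovableSingularity Ω (resonantRHS a b c β δ) γ F) (M : ℝ) :
    ∀ᶠ s in 𝓝[<] (1 : ℝ), ¬ (‖F s (γ s)‖ ≤ M ∧ ‖deriv (F s) (γ s)‖ ≤ M) := by
  by_contra hcon
  have hfreq : ∃ᶠ s in 𝓝[<] (1 : ℝ),
      (F s (γ s), deriv (F s) (γ s)) ∈ Metric.closedBall (0 : ℂ × ℂ) M := by
    refine fun h => hcon (h.mono fun s hs => ?_)
    simpa [Prod.norm_def] using hs
  obtain ⟨x, -, hx⟩ :=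
    (isCompact_closedBall (0 : ℂ × ℂ) M).exists_mapClusterPt_of_frequently hfreq
  have h1Ω : γ 1 ∈ Ω := H.mapsTo ⟨zero_le_one, le_rfl⟩
  let f : ℂ × (ℂ × ℂ) → ℂ × ℂ := fun q => (q.2.2, resonantRHS a b c β δ q.1 q.2.1)
  have hf : ∀ q : ℂ × (ℂ × ℂ), q.1 ∈ Ω → ContDiffAt ℂ 1 f q := fun q hq =>
    (contDiffAt_snd.snd).prodMk
      (contDiffAt_resonantRHS hβ hδ contDiffAt_fst hq (contDiffAt_snd.fst))
  obtain ⟨r, hr, hex⟩ := exists_forall_mem_ball_hasDerivAt (hf (γ 1, x) h1Ω) univ_mem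
  obtain ⟨s₁, hs₁, hball⟩ := exists_forall_Ico_of_eventually zero_lt_one
    (H.tendsto_path.eventually (Metric.ball_mem_nhds (γ 1) hr))
  obtain ⟨s, ⟨Y, hY0, hY⟩, hs⟩ := (((H.tendsto_path.mapClusterPt_prodMk hx).frequently
    hex).and_eventually (Ico_mem_nhdsLT hs₁.2)).exists
  have hsub : Ico s 1 ⊆ Ico s₁ 1 := Ico_subset_Ico_left hs.1
  have hsub0 : Ico s 1 ⊆ Ico 0 1 := Ico_subset_Ico_left (hs₁.1.trans hs.1)
  have hss : s ∈ Ico s 1 := ⟨le_rfl, hs.2⟩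
  simp only at hY0
  have hYan : ∀ z ∈ Metric.ball (γ 1) r, AnalyticAt ℂ (fun z => (Y z).1) z := fun z hz =>
    DifferentiableOn.analyticAt (s := Metric.ball (γ 1) r)
      (fun w hw => (hY w hw).1.differentiableAt.fst.differentiableWithinAt)
      (Metric.isOpen_ball.mem_nhds hz)
  have hstart : (fun z => (F s z, deriv (F s) z)) =ᶠ[𝓝 (γ s)] Y := by
    refine eventuallyEq_of_hasDerivAt (f := f)
      (hf _ (H.mapsTo (Ico_subset_Icc_self (hsub0 hss)))) ?_ ?_ hY0.symm
    · filter_upwards [H.solution_of_mem hβ hδ (hsub0 hss)] with z hz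
      exact hz.1.prodMk hz.2
    · filter_upwards [Metric.isOpen_ball.mem_nhds (hball s (hsub hss))] with z hz
      exact (hY z hz).1
  refine H.singular ⟨fun z => (Y z).1, hYan _ (Metric.mem_ball_self hr), ?_⟩
  have hprop := eventuallyEq_zero_of_continuation (G := fun s z => F s z - (Y z).1)
    (a := s) (b := 1)
    (H.continuousOn.mono (hsub0.trans Ico_subset_Icc_self))
    (fun s' hs' => (H.continuation.analyticAt s' (hsub0 hs')).sub (hYan _ (hball s' (hsub hs'))))
    (fun s' hs' => by
      filter_upwards [nhdsWithin_mono _ hsub0 (H.continuation.compatible s' (hsub0 hs'))]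
        with s'' h
      filter_upwards [h] with z hz
      rw [hz])
    (by
      filter_upwards [hstart] with z hz
      simp [← hz])
  refine eventually_nhdsLT_of_forall_Ico hs.2 fun s' hs' => ?_
  filter_upwards [hprop s' hs'] with z hz
  exact sub_eq_zero.1 hz

/-- Since the energy is bounded, `y` itself tends to infinity. -/
theorem ReachesMovableSingularity.eventually_lt_norm (hβ : AnalyticOnNhd ℂ β Ω)
    (hδ : AnalyticOnNhd ℂ δ Ω)
    (H : ReachesMovableSingularity Ω (resonantRHS a b c β δ) γ F) {K : Set ℂ} (hK : IsCompact K)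
    (hKΩ : K ⊆ Ω) (hKn : K ∈ 𝓝 (γ 1)) (N : ℝ) :
    ∀ᶠ s in 𝓝[<] (1 : ℝ), N < ‖F s (γ s)‖ := by
  obtain ⟨B, hB⟩ := H.exists_energy_bound hβ hδ hK hKΩ hKn
  have hKc := hK.prod (isCompact_closedBall (0 : ℂ) N)
  obtain ⟨M₁, h₁⟩ := hKc.exists_bound_of_continuousOn
    (f := fun q => (cutoff q.2 : ℂ) * slopeCorrection a β δ q) fun q hq =>
      (contDiffAt_cutoff_mul
        (contDiffAt_slopeCorrection hβ hδ (hKΩ hq.1))).continuousAt.continuousWithinAt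
  obtain ⟨M₂, h₂⟩ := hKc.exists_bound_of_continuousOn
    (f := fun q => (cutoff q.2 : ℂ) * constCorrection β q - potential a b c β δ q) fun q hq =>
      ((contDiffAt_cutoff_mul (contDiffAt_constCorrection hβ (hKΩ hq.1))).continuousAt.sub
        (contDiffAt_potential hβ hδ (hKΩ hq.1)).continuousAt).continuousWithinAt
  set M := max M₁ M₂
  filter_upwards [hB, H.tendsto_path.eventually hKn,
    H.eventually_not_bounded hβ hδ (max N (2 * B + M ^ 2 + 2 * M + 1))] with s hs hsK hnb
  by_contra hle
  rw [not_lt] at hle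
  have hq : (γ s, F s (γ s)) ∈ K ×ˢ Metric.closedBall (0 : ℂ) N := ⟨hsK, by simpa using hle⟩
  refine hnb ⟨hle.trans (le_max_left _ _), le_trans ?_ (le_max_right _ _)⟩
  have h3 := sq_norm_le_of_quadratic (p := deriv (F s) (γ s))
    ((h₁ _ hq).trans (le_max_left M₁ M₂)) ((h₂ _ hq).trans (le_max_right M₁ M₂))
  have h4 : ‖deriv (F s) (γ s)‖ ^ 2 ≤ 2 * B + M ^ 2 + 2 * M := by
    refine h3.trans ?_
    have : ‖cutoffEnergy a b c β δ (γ s) (F s (γ s)) (deriv (F s) (γ s))‖ ≤ B := hs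
    rw [cutoffEnergy] at this
    gcongr
  nlinarith [sq_nonneg (‖deriv (F s) (γ s)‖ - 1)]

/-- The equation with `u = 1 / y` as independent variable, for the unknowns `z`, `W` and
`v = y' / y³`. It is regular at `u = 0` as long as `v ≠ 0`. -/
noncomputable def regularizedField (a b c : ℂ) (β δ : ℂ → ℂ) (q : ℂ × (ℂ × ℂ × ℂ)) : ℂ × ℂ × ℂ :=
  (-(q.1 / q.2.2.2)) • ((1 : ℂ), energyRate a b c β δ q.2.1 q.1 q.2.2.1 q.2.2.2,
    slopeRate a b c β δ q.2.1 q.1 q.2.2.1 q.2.2.2)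

theorem contDiffAt_regularizedField {E : Type*} [NormedAddCommGroup E] [NormedSpace ℂ E]
    {g : E → ℂ × (ℂ × ℂ × ℂ)} {x : E}
    (hβ : AnalyticOnNhd ℂ β Ω) (hδ : AnalyticOnNhd ℂ δ Ω) (hg : ContDiffAt ℂ 1 g x)
    (hz : (g x).2.1 ∈ Ω) (hv : (g x).2.2.2 ≠ 0) :
    ContDiffAt ℂ 1 (fun x => regularizedField a b c β δ (g x)) x := by
  have h1 : ContDiffAt ℂ 1 (fun x => (g x).1) x := hg.fst
  have h2 : ContDiffAt ℂ 1 (fun x => (g x).2.1) x := hg.snd.fst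
  have h3 : ContDiffAt ℂ 1 (fun x => (g x).2.2.1) x := hg.snd.snd.fst
  have h4 : ContDiffAt ℂ 1 (fun x => (g x).2.2.2) x := hg.snd.snd.snd
  exact ((h1.div h4 hv).neg).smul (contDiffAt_const.prodMk
    ((contDiffAt_energyRate hβ hδ h2 hz h1 h3 h4).prodMk
      (contDiffAt_slopeRate hβ hδ h2 hz h1 h3 h4)))

/-- Near the singularity, `z` is an analytic function of `u = 1 / y`, and this function is defined on
a full neighbourhood of `u = 0`. -/
theorem ReachesMovableSingularity.exists_inverse (hΩ : IsOpen Ω) (hβ : AnalyticOnNhd ℂ β Ω)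
    (hδ : AnalyticOnNhd ℂ δ Ω)
    (H : ReachesMovableSingularity Ω (resonantRHS a b c β δ) γ F) :
    ∃ r > (0 : ℝ), ∃ Z V : ℂ → ℂ, AnalyticAt ℂ V 0 ∧
      Tendsto (fun s => 1 / F s (γ s)) (𝓝[<] 1) (𝓝 0) ∧
      (∀ u ∈ Metric.ball (0 : ℂ) r, HasDerivAt Z (-(u / V u)) u ∧ V u ≠ 0) ∧
      ∃ s₀ ∈ Ico (0 : ℝ) 1, ∀ s ∈ Ico s₀ 1, F s (γ s) ≠ 0 ∧
        1 / F s (γ s) ∈ Metric.ball (0 : ℂ) r ∧ ∀ᶠ z in 𝓝 (γ s), Z (1 / F s z) = z := by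
  have h1Ω : γ 1 ∈ Ω := H.mapsTo ⟨zero_le_one, le_rfl⟩
  obtain ⟨K, hKn, hKΩ, hK⟩ := local_compact_nhds (hΩ.mem_nhds h1Ω)
  obtain ⟨B, hB⟩ := H.exists_energy_bound hβ hδ hK hKΩ hKn
  obtain ⟨M, hM, hMs⟩ := exists_norm_slope_le (a := a) (b := b) (c := c) hβ hδ hK hKΩ
  have hlarge := H.eventually_lt_norm hβ hδ hK hKΩ hKn
  set y : ℝ → ℂ := fun s => F s (γ s) with hy
  set W : ℝ → ℂ := fun s => modifiedEnergy a b c β δ (γ s) (F s (γ s)) (deriv (F s) (γ s))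
  set v : ℝ → ℂ := fun s => deriv (F s) (γ s) / F s (γ s) ^ 3
  have hu : Tendsto (fun s => 1 / y s) (𝓝[<] 1) (𝓝 0) := by
    have : Tendsto y (𝓝[<] 1) (Bornology.cobounded ℂ) :=
      tendsto_norm_atTop_iff_cobounded.1 (tendsto_atTop.2 fun N => (hlarge N).mono fun s hs => hs.le)
    simpa [Function.comp_def] using tendsto_inv₀_cobounded.comp this
  have hWv : ∀ᶠ s in 𝓝[<] (1 : ℝ),
      (W s, v s) ∈ Metric.closedBall (0 : ℂ) B ×ˢ Metric.closedBall (0 : ℂ) (M * (1 + B)) := by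
    filter_upwards [hB, H.tendsto_path.eventually hKn, hlarge 2] with s hs hsK hs2
    rw [cutoffEnergy_eq hs2.le] at hs
    refine ⟨by simpa using hs, ?_⟩
    have := hMs (γ s) hsK (F s (γ s)) (deriv (F s) (γ s)) (by linarith)
    simp only [mem_closedBall_zero_iff]
    refine this.trans ?_
    gcongr
  obtain ⟨⟨W₁, v₁⟩, -, hx⟩ := ((isCompact_closedBall (0 : ℂ) B).prod
    (isCompact_closedBall (0 : ℂ) (M * (1 + B)))).exists_mapClusterPt_of_frequently hWv.frequently
  -- In the limit `u → 0` the relation between `v` and `W` reads `v² = 1`.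
  have hv₁ : v₁ ^ 2 = 1 := by
    let g : (ℂ × ℂ) × (ℂ × ℂ) → ℂ := fun q =>
      q.2.2 ^ 2 - (1 + slopeSqDefect a b c β δ q.1.2 q.1.1 q.2.1 q.2.2)
    have hg : ContinuousAt g ((0, γ 1), (W₁, v₁)) :=
      (continuousAt_snd.snd.pow 2).sub (continuousAt_const.add
        (contDiffAt_slopeSqDefect hβ hδ (contDiffAt_fst.snd) h1Ω (contDiffAt_fst.fst)
          (contDiffAt_snd.fst) (contDiffAt_snd.snd)).continuousAt)
    have hcl : MapClusterPt ((0, γ 1), (W₁, v₁)) (𝓝[<] (1 : ℝ))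
        (fun s => ((1 / y s, γ s), (W s, v s))) :=
      (hu.prodMk_nhds H.tendsto_path).mapClusterPt_prodMk hx
    have hz : ∀ᶠ s in 𝓝[<] (1 : ℝ), g ((1 / y s, γ s), (W s, v s)) = 0 := by
      filter_upwards [hlarge 0] with s hs
      exact sub_eq_zero.2 (slope_sq_eq (γ s) (deriv (F s) (γ s)) (norm_pos_iff.1 hs))
    have h0 : g ((0, γ 1), (W₁, v₁)) = 0 := by
      by_contra hne
      obtain ⟨s, hs⟩ := ((hcl.frequently (hg.eventually_ne hne)).and_eventually hz).exists
      exact hs.1 hs.2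
    have : v₁ ^ 2 - (1 + slopeSqDefect a b c β δ (γ 1) 0 W₁ v₁) = 0 := h0
    simpa [slopeSqDefect, sub_eq_zero] using this
  have hv₁0 : v₁ ≠ 0 := by
    rintro rfl
    norm_num at hv₁
  have hf : ContDiffAt ℂ 1 (regularizedField a b c β δ) (0, (γ 1, W₁, v₁)) :=
    contDiffAt_regularizedField hβ hδ contDiffAt_id h1Ω hv₁0
  have hN : {q : ℂ × (ℂ × ℂ × ℂ) | q.2.1 ∈ Ω ∧ q.2.2.2 ≠ 0} ∈ 𝓝 ((0 : ℂ), (γ 1, W₁, v₁)) := by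
    have hop : IsOpen {q : ℂ × (ℂ × ℂ × ℂ) | q.2.1 ∈ Ω ∧ q.2.2.2 ≠ 0} :=
      (hΩ.preimage (by fun_prop)).inter (isOpen_ne.preimage (by fun_prop))
    exact hop.mem_nhds ⟨h1Ω, hv₁0⟩
  obtain ⟨r, hr, hex⟩ := exists_forall_mem_ball_hasDerivAt hf hN
  have hcl : ∃ᶠ s in 𝓝[<] (1 : ℝ), ∃ X : ℂ → ℂ × ℂ × ℂ, X (1 / y s) = (γ s, W s, v s) ∧
      ∀ ζ ∈ Metric.ball (0 : ℂ) r, HasDerivAt X (regularizedField a b c β δ (ζ, X ζ)) ζ ∧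
        (ζ, X ζ) ∈ {q : ℂ × (ℂ × ℂ × ℂ) | q.2.1 ∈ Ω ∧ q.2.2.2 ≠ 0} := by
    exact (hu.mapClusterPt_prodMk (H.tendsto_path.mapClusterPt_prodMk hx)).frequently hex
  obtain ⟨s₁, hs₁, hs₁P⟩ := exists_forall_Ico_of_eventually zero_lt_one
    ((hlarge 0).and (hu.eventually (Metric.ball_mem_nhds _ hr)))
  obtain ⟨s, ⟨X, hX0, hX⟩, hs⟩ := (hcl.and_eventually (Ico_mem_nhdsLT hs₁.2)).exists
  have hsub : Ico s 1 ⊆ Ico s₁ 1 := Ico_subset_Ico_left hs.1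
  have hsub0 : Ico s 1 ⊆ Ico 0 1 := Ico_subset_Ico_left (hs₁.1.trans hs.1)
  have hss : s ∈ Ico s 1 := ⟨le_rfl, hs.2⟩
  have hy0 : ∀ s' ∈ Ico s 1, F s' (γ s') ≠ 0 := fun s' hs' =>
    norm_pos_iff.1 (hs₁P s' (hsub hs')).1
  have hub : ∀ s' ∈ Ico s 1, 1 / F s' (γ s') ∈ Metric.ball (0 : ℂ) r := fun s' hs' =>
    (hs₁P s' (hsub hs')).2
  have hZan : ∀ u ∈ Metric.ball (0 : ℂ) r, AnalyticAt ℂ (fun u => (X u).1) u := fun u hu =>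
    DifferentiableOn.analyticAt (s := Metric.ball (0 : ℂ) r)
      (fun w hw => (hX w hw).1.differentiableAt.fst.differentiableWithinAt)
      (Metric.isOpen_ball.mem_nhds hu)
  have hVan : AnalyticAt ℂ (fun u => (X u).2.2) 0 :=
    DifferentiableOn.analyticAt (s := Metric.ball (0 : ℂ) r)
      (fun w hw => (hX w hw).1.differentiableAt.snd.snd.differentiableWithinAt)
      (Metric.ball_mem_nhds 0 hr)
  refine ⟨r, hr, fun u => (X u).1, fun u => (X u).2.2, hVan, hu, fun u hu => ⟨?_, (hX u hu).2.2⟩,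
    s, ⟨hs₁.1.trans hs.1, hs.2⟩, fun s' hs' => ⟨hy0 s' hs', hub s' hs', ?_⟩⟩
  · have := (hasFDerivAt_fst (p := X u)).comp_hasDerivAt u (hX u hu).1
    simpa [regularizedField, Function.comp_def] using this
  -- Both `(z, W, v)` and `X (1 / y)` solve the same equation in `z`.
  have hstart : (fun z => (z, modifiedEnergy a b c β δ z (F s z) (deriv (F s) z),
      deriv (F s) z / F s z ^ 3)) =ᶠ[𝓝 (γ s)] fun z => X (1 / F s z) := by
    have han := H.continuation.analyticAt s (hsub0 hss)
    have hsΩ : γ s ∈ Ω := H.mapsTo (Ico_subset_Icc_self (hsub0 hss))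
    have hvs : deriv (F s) (γ s) / F s (γ s) ^ 3 ≠ 0 := by
      have := (hX _ (hub s hss)).2.2
      rw [show X (1 / F s (γ s)) = (γ s, W s, v s) from hX0] at this
      exact this
    have hps : deriv (F s) (γ s) ≠ 0 := fun h => hvs (by simp [h])
    have hFev : ∀ᶠ z in 𝓝 (γ s), F s z ≠ 0 := han.continuousAt.eventually_ne (hy0 s hss)
    have hpev : ∀ᶠ z in 𝓝 (γ s), deriv (F s) z ≠ 0 := han.deriv.continuousAt.eventually_ne hps
    have huc : ContinuousAt (fun z => 1 / F s z) (γ s) :=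
      continuousAt_const.div han.continuousAt (hy0 s hss)
    refine eventuallyEq_of_hasDerivAt
      (f := fun q => (-(deriv (F s) q.1 / F s q.1 ^ 2)) •
        regularizedField a b c β δ (1 / F s q.1, q.2)) ?_ ?_ ?_ hX0.symm
    · have e1 : ContDiffAt ℂ 1 (fun q : ℂ × (ℂ × ℂ × ℂ) => F s q.1)
          (γ s, (γ s, W s, v s)) := ContDiffAt.comp (g := F s) (f := Prod.fst) _ han.contDiffAt
            contDiffAt_fst
      have e2 : ContDiffAt ℂ 1 (fun q : ℂ × (ℂ × ℂ × ℂ) => deriv (F s) q.1)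
          (γ s, (γ s, W s, v s)) := ContDiffAt.comp (g := deriv (F s)) (f := Prod.fst) _
            han.deriv.contDiffAt contDiffAt_fst
      exact ((e2.div (e1.pow 2) (pow_ne_zero 2 (hy0 s hss))).neg).smul
        (contDiffAt_regularizedField hβ hδ
          ((contDiffAt_const.div e1 (hy0 s hss)).prodMk contDiffAt_snd) hsΩ hvs)
    · filter_upwards [H.solution_of_mem hβ hδ (hsub0 hss), hFev, hpev, hΩ.mem_nhds hsΩ]
        with z hz hz0 hz1 hzΩ
      have d1 := hasDerivAt_modifiedEnergy (hβ z hzΩ) (hδ z hzΩ) hz0 hz.1 hz.2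
      have d2 := hasDerivAt_slope hz0 hz.1 hz.2
      refine ((hasDerivAt_id z).prodMk (d1.prodMk d2)).congr_deriv ?_
      have e : -(deriv (F s) z / F s z ^ 2) * -(1 / F s z / (deriv (F s) z / F s z ^ 3)) = 1 := by
        field_simp
      simp only [regularizedField, smul_smul, e, one_smul]
    · filter_upwards [H.solution_of_mem hβ hδ (hsub0 hss), hFev,
        huc.eventually (Metric.isOpen_ball.mem_nhds (hub s hss))] with z hz hz0 hzb
      have d1 : HasDerivAt (fun z => 1 / F s z) (-(deriv (F s) z / F s z ^ 2)) z := by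
        refine ((hasDerivAt_const z (1 : ℂ)).div hz.1 hz0).congr_deriv ?_
        ring
      exact (hX _ hzb).1.scomp z d1
  have hprop := eventuallyEq_zero_of_continuation (G := fun s z => (X (1 / F s z)).1 - z)
    (a := s) (b := 1)
    (H.continuousOn.mono (hsub0.trans Ico_subset_Icc_self))
    (fun t ht => by
      have h1 : AnalyticAt ℂ (fun z => 1 / F t z) (γ t) :=
        analyticAt_const.div (H.continuation.analyticAt t (hsub0 ht)) (hy0 t ht)
      exact (AnalyticAt.comp_of_eq (hZan _ (hub t ht)) h1 rfl).sub analyticAt_id)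
    (fun t ht => by
      filter_upwards [nhdsWithin_mono _ hsub0 (H.continuation.compatible t (hsub0 ht))]
        with t' h
      filter_upwards [h] with z hz
      rw [hz])
    (by
      filter_upwards [hstart] with z hz
      exact sub_eq_zero.2 (congrArg Prod.fst hz).symm)
  filter_upwards [hprop s' hs'] with z hz
  exact sub_eq_zero.1 hz

end Path

/-! ### Puiseux series -/

/-- An analytic function with a double zero is the square of a local coordinate. -/
theorem exists_sq_eq_of_analyticOrderAt_eq_two {f : ℂ → ℂ} (hf : AnalyticAt ℂ f 0)
    (h2 : analyticOrderAt f 0 = 2) :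
    ∃ T : ℂ → ℂ, AnalyticAt ℂ T 0 ∧ T 0 = 0 ∧ deriv T 0 ≠ 0 ∧ ∀ᶠ u in 𝓝 0, f u = T u ^ 2 := by
  obtain ⟨h, hh, hh0, hfh⟩ := (hf.analyticOrderAt_eq_natCast (n := 2)).1 h2
  obtain ⟨s, hs⟩ := IsAlgClosed.exists_pow_nat_eq (h 0) zero_lt_two
  have hs0 : s ≠ 0 := by
    rintro rfl
    exact hh0 (by simp [← hs])
  let k : ℂ → ℂ := fun u => s * (h u / h 0) ^ (((2 : ℕ) : ℂ)⁻¹)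
  have hk : AnalyticAt ℂ k 0 := by
    refine analyticAt_const.mul ((hh.div analyticAt_const hh0).cpow analyticAt_const ?_)
    simp [hh0]
  have hk2 : ∀ u, k u ^ 2 = h u := fun u => by
    simp only [k]
    rw [mul_pow, Complex.cpow_nat_inv_pow _ two_ne_zero, hs]
    field_simp
  have hk0 : k 0 ≠ 0 := fun h0 => hh0 (by rw [← hk2, h0]; simp)
  refine ⟨fun u => u * k u, analyticAt_id.mul hk, by simp, ?_, ?_⟩
  · have := (hasDerivAt_id (0 : ℂ)).mul hk.differentiableAt.hasDerivAt
    have h3 : HasDerivAt (fun u => u * k u) (k 0) 0 := by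
      refine this.congr_deriv ?_
      simp
    rw [h3.deriv]
    exact hk0
  · filter_upwards [hfh] with u hu
    rw [hu, mul_pow, hk2]
    simp

/-- If `z` is an analytic function of `1 / y` near `1 / y = 0` with a double point there, then `y` has
an expansion in powers of `(z - z⋆) ^ (1 / 2)` starting with the exponent `-1 / 2`. -/
theorem exists_hasPuiseuxExpansion_of_inverse {γ : ℝ → ℂ} {F : ℝ → ℂ → ℂ}
    (hγ : ContinuousOn γ (Icc 0 1)) (hγ1 : Tendsto γ (𝓝[<] 1) (𝓝 (γ 1)))
    (hF : IsAnalyticContinuationAlong γ F) {r : ℝ} (hr : 0 < r) {Z V : ℂ → ℂ}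
    (hV : AnalyticAt ℂ V 0) (hu : Tendsto (fun s => 1 / F s (γ s)) (𝓝[<] 1) (𝓝 0))
    (hZ : ∀ u ∈ Metric.ball (0 : ℂ) r, HasDerivAt Z (-(u / V u)) u ∧ V u ≠ 0) {s₀ : ℝ}
    (hs₀ : s₀ ∈ Ico (0 : ℝ) 1)
    (hinv : ∀ s ∈ Ico s₀ 1, F s (γ s) ≠ 0 ∧ 1 / F s (γ s) ∈ Metric.ball (0 : ℂ) r ∧
      ∀ᶠ z in 𝓝 (γ s), Z (1 / F s z) = z) :
    ∃ k : ℕ → ℂ, k 0 ≠ 0 ∧ HasPuiseuxExpansion γ F 2 1 k := by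
  have h0 := Metric.mem_ball_self hr (x := (0 : ℂ))
  have hball := Metric.ball_mem_nhds (0 : ℂ) hr
  have hZan : AnalyticAt ℂ Z 0 := DifferentiableOn.analyticAt (s := Metric.ball (0 : ℂ) r)
    (fun w hw => (hZ w hw).1.differentiableAt.differentiableWithinAt) hball
  have hZ0 : Z 0 = γ 1 := by
    refine tendsto_nhds_unique (hZan.continuousAt.tendsto.comp hu) (hγ1.congr' ?_)
    filter_upwards [eventually_nhdsLT_of_forall_Ico hs₀.2 hinv] with s hs
    exact hs.2.2.self_of_nhds.symm
  -- The derivative `-u / V` of `Z` has a simple zero, so `Z - γ 1` has a double zero.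
  have hord : analyticOrderAt (fun u => Z u - γ 1) 0 = 2 := by
    have han : AnalyticAt ℂ (fun u => Z u - γ 1) 0 := hZan.sub analyticAt_const
    have h1 : analyticOrderAt (deriv fun u => Z u - γ 1) 0 = (1 : ℕ) := by
      rw [han.deriv.analyticOrderAt_eq_natCast]
      refine ⟨fun u => -(1 / V u), (analyticAt_const.div hV (hZ 0 h0).2).neg, ?_, ?_⟩
      · simpa using (hZ 0 h0).2
      · filter_upwards [hball] with u hu
        rw [((hZ u hu).1.sub_const (γ 1)).deriv]
        simp [div_eq_mul_inv]
    have h2 := (analyticOrderAt_deriv_eq_iff han (by simp [hZ0])).2 h1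
    rw [h2]
    norm_num
  obtain ⟨T, hT, hT0, hT1, hZT⟩ := exists_sq_eq_of_analyticOrderAt_eq_two
    (hZan.sub analyticAt_const) hord
  set ψ := hT.hasStrictDerivAt.localInverse T (deriv T 0) 0 hT1
  have hψ : AnalyticAt ℂ ψ 0 := hT0 ▸ hT.analyticAt_localInverse hT1
  have hψT : ∀ᶠ u in 𝓝 0, ψ (T u) = u := hT.hasStrictDerivAt.eventually_left_inverse hT1
  have hψ0 : ψ 0 = 0 := by simpa [hT0] using hψT.self_of_nhds
  have hψ1 : deriv ψ 0 ≠ 0 := by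
    have h := hT.hasStrictDerivAt.to_localInverse hT1
    rw [hT0] at h
    rw [h.hasDerivAt.deriv]
    exact inv_ne_zero hT1
  obtain ⟨m, hm, hm0, hψm⟩ : ∃ m, AnalyticAt ℂ m 0 ∧ m 0 ≠ 0 ∧ ∀ᶠ t in 𝓝 0, ψ t = t * m t := by
    have h1 : analyticOrderAt ψ 0 = (1 : ℕ) := by
      have := (analyticOrderAt_deriv_eq_iff hψ hψ0 (n := 0)).2
        (by simpa using hψ.deriv.analyticOrderAt_eq_zero.2 hψ1)
      simpa using this
    obtain ⟨m, hm, hm0, h⟩ := hψ.analyticOrderAt_eq_natCast.1 h1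
    exact ⟨m, hm, hm0, h.mono fun t ht => by simpa using ht⟩
  set g : ℂ → ℂ := fun t => (m t)⁻¹ with hg
  have hgan : AnalyticAt ℂ g 0 := hm.inv hm0
  obtain ⟨R, hR, hRball⟩ := Metric.eventually_nhds_iff_ball.1 (hgan.eventually_analyticAt.and hψm)
  have hgd : DifferentiableOn ℂ g (Metric.ball 0 R) := fun t ht =>
    (hRball t ht).1.differentiableAt.differentiableWithinAt
  let k : ℕ → ℂ := fun j => ((j.factorial : ℂ))⁻¹ * iteratedDeriv j g 0
  have hsum : ∀ t : ℂ, t ≠ 0 → ‖t‖ < R →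
      HasSum (fun j : ℕ => k j * t ^ ((j : ℤ) - ((1 : ℕ) : ℤ))) (1 / ψ t) := by
    intro t ht htR
    have htb : t ∈ Metric.ball (0 : ℂ) R := by simpa using htR
    have h := (Complex.hasSum_taylorSeries_on_ball hgd htb).mul_right (t⁻¹)
    have e : 1 / ψ t = g t * t⁻¹ := by
      rw [(hRball t htb).2, hg]
      simp only [one_div, mul_inv]
      ring
    rw [e]
    refine h.congr_fun fun j => ?_
    simp only [k, sub_zero, smul_eq_mul, zpow_sub₀ ht, zpow_natCast, pow_one]
    ring_nf
  have hcontu : ContinuousOn (fun s => 1 / F s (γ s)) (Ico s₀ 1) := by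
    have h1 := hF.continuousOn_jet (hγ.mono Ico_subset_Icc_self)
    exact continuousOn_const.div (h1.fst.mono (Ico_subset_Ico_left hs₀.1)) fun s hs =>
      (hinv s hs).1
  have hnear : ∀ᶠ u in 𝓝 0, AnalyticAt ℂ T u ∧ ‖T u‖ < R ∧ ∀ᶠ u' in 𝓝 u,
      Z u' - γ 1 = T u' ^ 2 ∧ ψ (T u') = u' := by
    refine hT.eventually_analyticAt.and (Eventually.and ?_
      (eventually_eventually_nhds.2 (hZT.and hψT)))
    exact hT.continuousAt.norm.eventually (gt_mem_nhds (by simpa [hT0] using hR))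
  obtain ⟨s₁, hs₁, hs₁P⟩ := exists_forall_Ico_of_eventually hs₀.2 (hu.eventually hnear)
  have hsub : Ico s₁ 1 ⊆ Ico s₀ 1 := Ico_subset_Ico_left hs₁.1
  refine ⟨k, ?_, R, hR, fun t ht htR => (hsum t (norm_pos_iff.1 ht) htR).summable, s₁,
    ⟨hs₀.1.trans hs₁.1, hs₁.2⟩, fun s => T (1 / F s (γ s)), ?_, ?_⟩
  · simpa [k, hg] using hm0
  · exact fun s hs => ContinuousAt.comp_continuousWithinAt (g := T)
      (hs₁P s hs).1.continuousAt ((hcontu s (hsub hs)).mono hsub)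
  intro s hs
  obtain ⟨hTan, hTR, hTev⟩ := hs₁P s hs
  obtain ⟨hF0, hub, hZF⟩ := hinv s (hsub hs)
  set u := 1 / F s (γ s) with hu_def
  have hu0 : u ≠ 0 := one_div_ne_zero hF0
  have hτ0 : T u ≠ 0 := fun h => hu0 (by rw [← hTev.self_of_nhds.2, h, hψ0])
  have hγs : γ s = γ 1 + T u ^ 2 := by
    rw [← hTev.self_of_nhds.1, hZF.self_of_nhds]
    ring
  refine ⟨hτ0, hTR, hγs, ?_⟩
  have hsq : Tendsto (fun t : ℂ => γ 1 + t ^ 2) (𝓝 (T u)) (𝓝 (γ s)) := by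
    rw [hγs]
    exact Continuous.tendsto (by fun_prop) _
  have hFan := hF.analyticAt s ⟨hs₀.1.trans (hsub hs).1, hs.2⟩
  have hut : Tendsto (fun t : ℂ => 1 / F s (γ 1 + t ^ 2)) (𝓝 (T u)) (𝓝 u) :=
    (continuousAt_const.div hFan.continuousAt hF0).tendsto.comp hsq
  have hne : ∀ᶠ t in 𝓝 (T u), T (1 / F s (γ 1 + t ^ 2)) + t ≠ 0 := by
    have h1 : Tendsto (fun t => T (1 / F s (γ 1 + t ^ 2)) + t) (𝓝 (T u)) (𝓝 (T u + T u)) :=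
      (hTan.continuousAt.tendsto.comp hut).add tendsto_id
    exact h1.eventually_ne (by simpa [← two_mul] using hτ0)
  filter_upwards [hsq.eventually hZF, hut.eventually hTev, hne,
    isOpen_ne.mem_nhds hτ0, (continuous_norm.isOpen_preimage _ isOpen_Iio).mem_nhds hTR]
    with t h1 h2 h3 h4 h5
  have h6 : T (1 / F s (γ 1 + t ^ 2)) = t := by
    have h7 : T (1 / F s (γ 1 + t ^ 2)) ^ 2 = t ^ 2 := by
      rw [← h2.1, h1]
      ring
    rcases sq_eq_sq_iff_eq_or_eq_neg.1 h7 with h8 | h8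
    · exact h8
    · exact absurd (by rw [h8]; ring) h3
  have h9 : F s (γ 1 + t ^ 2) = 1 / ψ t := by
    have := h2.2
    rw [h6] at this
    rw [this, one_div_one_div]
  rw [h9]
  exact hsum t h4 h5

/-- The analytic part of a convergent Laurent series with finite principal part. -/
theorem exists_analytic_part {c : ℕ → ℂ} {j₀ : ℕ} {R : ℝ} (hR : 0 < R)
    (hs : ∀ t : ℂ, 0 < ‖t‖ → ‖t‖ < R → Summable fun j : ℕ => c j * t ^ ((j : ℤ) - (j₀ : ℤ))) :
    ∃ g : ℂ → ℂ, DifferentiableOn ℂ g (Metric.ball 0 R) ∧ g 0 = c 0 ∧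
      ∀ t x : ℂ, 0 < ‖t‖ → ‖t‖ < R →
        HasSum (fun j : ℕ => c j * t ^ ((j : ℤ) - (j₀ : ℤ))) x → g t = t ^ j₀ * x := by
  set p := FormalMultilinearSeries.ofScalars ℂ c with hp
  have hmul : ∀ t : ℂ, t ≠ 0 → ∀ j : ℕ,
      t ^ j₀ * (c j * t ^ ((j : ℤ) - (j₀ : ℤ))) = c j * t ^ j := by
    intro t ht j
    rw [zpow_sub₀ ht, zpow_natCast, zpow_natCast]
    field_simp
  have hrad : ENNReal.ofReal R ≤ p.radius := by
    refine ENNReal.le_of_forall_nnreal_lt fun ρ hρ => ?_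
    rcases eq_or_ne ρ 0 with rfl | hρ0
    · simp
    have hρR : (ρ : ℝ) < R := by
      rwa [← ENNReal.ofReal_coe_nnreal, ENNReal.ofReal_lt_ofReal_iff hR] at hρ
    have hρ1 : 0 < (ρ : ℝ) := NNReal.coe_pos.2 (pos_iff_ne_zero.2 hρ0)
    have hn : ‖((ρ : ℝ) : ℂ)‖ = ρ := by simp
    have h1 := (hs ((ρ : ℝ) : ℂ) (by rw [hn]; exact hρ1) (by rw [hn]; exact hρR)).mul_left
      (((ρ : ℝ) : ℂ) ^ j₀)
    simp only [hmul _ (Complex.ofReal_ne_zero.2 hρ1.ne')] at h1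
    refine p.le_radius_of_tendsto (l := 0) ?_
    have h2 := h1.tendsto_atTop_zero.norm
    simpa [hp, FormalMultilinearSeries.ofScalars_norm] using h2
  have hpos : 0 < p.radius := lt_of_lt_of_le (ENNReal.ofReal_pos.2 hR) hrad
  have hfp := p.hasFPowerSeriesOnBall hpos
  have hmem : ∀ t : ℂ, ‖t‖ < R → t ∈ Metric.eball (0 : ℂ) p.radius := fun t ht => by
    refine Metric.eball_subset_eball hrad ?_
    rw [Metric.eball_ofReal]
    simpa using ht
  refine ⟨p.sum, fun t ht => ?_, ?_, fun t x ht htR hx => ?_⟩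
  · exact (hfp.analyticAt_of_mem
      (hmem t (by simpa using ht))).differentiableAt.differentiableWithinAt
  · have := hfp.coeff_zero (fun _ => 0)
    simpa [hp] using this.symm
  · have h1 := hfp.hasSum (hmem t htR)
    have h2 := hx.mul_left (t ^ j₀)
    simp only [hmul t (norm_pos_iff.1 ht)] at h2
    rw [zero_add] at h1
    refine h1.unique ?_
    simpa [hp, FormalMultilinearSeries.ofScalars_apply_eq, mul_comm] using h2

/-- An expansion in odd and even powers of `(z - z⋆) ^ (1 / 2)` starting with the exponent `-1 / 2` is
not a Laurent series in `z - z⋆`: multiplied by a suitable even power of the local coordinate, the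
one has an odd order at `z⋆`, whereas the other is even. -/
theorem not_hasPuiseuxExpansion_one {γ : ℝ → ℂ} {F : ℝ → ℂ → ℂ}
    (hγ1 : Tendsto γ (𝓝[<] 1) (𝓝 (γ 1))) {k : ℕ → ℂ} (hk : k 0 ≠ 0)
    (h2 : HasPuiseuxExpansion γ F 2 1 k) (j₀ : ℕ) (c : ℕ → ℂ) :
    ¬ HasPuiseuxExpansion γ F 1 j₀ c := by
  rintro ⟨R', hR', hsum', s₁, hs₁, τ', -, hτ'⟩
  obtain ⟨R, hR, hsum, s₀, hs₀, τ, -, hτ⟩ := h2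
  obtain ⟨g, hg, hg0, hgs⟩ := exists_analytic_part hR hsum
  obtain ⟨g', hg', -, hgs'⟩ := exists_analytic_part hR' hsum'
  set ρ := min R (min 1 R')
  have hρ : 0 < ρ := by positivity
  have hρR : ρ ≤ R := min_le_left _ _
  have hρ1 : ρ ≤ 1 := (min_le_right _ _).trans (min_le_left _ _)
  have hρR' : ρ ≤ R' := (min_le_right _ _).trans (min_le_right _ _)
  have hsqball : ∀ t ∈ Metric.ball (0 : ℂ) ρ, t ^ 2 ∈ Metric.ball (0 : ℂ) R' := by
    intro t ht
    rw [mem_ball_zero_iff] at ht ⊢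
    rw [norm_pow]
    nlinarith [norm_nonneg t]
  let Φ : ℂ → ℂ := fun t => g t * t ^ (2 * j₀) - t * g' (t ^ 2)
  have hΦd : DifferentiableOn ℂ Φ (Metric.ball 0 ρ) := by
    have e1 : DifferentiableOn ℂ g (Metric.ball 0 ρ) := hg.mono (Metric.ball_subset_ball hρR)
    have e2 : DifferentiableOn ℂ (fun t => g' (t ^ 2)) (Metric.ball 0 ρ) :=
      hg'.comp (differentiableOn_id.pow 2) hsqball
    exact (e1.mul (differentiableOn_id.pow _)).sub (differentiableOn_id.mul e2)
  have hsmall : ∀ᶠ s in 𝓝[<] (1 : ℝ), ‖γ s - γ 1‖ < ρ ^ 2 := by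
    have := (hγ1.sub_const (γ 1)).norm
    rw [sub_self, norm_zero] at this
    exact this.eventually (gt_mem_nhds (by positivity))
  obtain ⟨s, hs, hs0, hs1⟩ := (hsmall.and
    (inter_mem (Ico_mem_nhdsLT hs₀.2) (Ico_mem_nhdsLT hs₁.2))).exists
  obtain ⟨hτ0, -, hτγ, hτev⟩ := hτ s hs0
  obtain ⟨hτ0', -, hτγ', hτev'⟩ := hτ' s hs1
  have hττ : τ s ^ 2 = τ' s := by
    have := hτγ.symm.trans hτγ'
    simpa using this
  have hτρ : τ s ∈ Metric.ball (0 : ℂ) ρ := by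
    rw [mem_ball_zero_iff]
    rw [hτγ, add_sub_cancel_left, norm_pow] at hs
    exact lt_of_pow_lt_pow_left₀ 2 hρ.le hs
  have hΦ0 : Φ =ᶠ[𝓝 (τ s)] 0 := by
    have hsqt : Tendsto (fun t : ℂ => t ^ 2) (𝓝 (τ s)) (𝓝 (τ' s)) := by
      rw [← hττ]
      exact (continuous_pow 2).tendsto _
    filter_upwards [hτev, hsqt.eventually hτev', isOpen_ne.mem_nhds hτ0,
      Metric.isOpen_ball.mem_nhds hτρ] with t h1 h2 h3 h4
    have h5 : ‖t‖ < ρ := by simpa using h4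
    have e1 := hgs t _ (norm_pos_iff.2 h3) (h5.trans_le hρR) h1
    have e2 := hgs' (t ^ 2) _ (norm_pos_iff.2 (pow_ne_zero 2 h3))
      (by simpa using hsqball t h4) h2
    simp only [Φ, Pi.zero_apply]
    rw [e1, e2, pow_one, ← pow_mul]
    ring_nf
  have hΦ : EqOn Φ 0 (Metric.ball 0 ρ) :=
    (hΦd.analyticOnNhd Metric.isOpen_ball).eqOn_zero_of_preconnected_of_eventuallyEq_zero
      (convex_ball _ _).isPreconnected hτρ hΦ0
  have hodd : ∀ᶠ t in 𝓝[≠] (0 : ℂ), g t + g (-t) = 0 := by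
    filter_upwards [self_mem_nhdsWithin, nhdsWithin_le_nhds (Metric.ball_mem_nhds (0 : ℂ) hρ)]
      with t ht htb
    have e1 : g t * t ^ (2 * j₀) - t * g' (t ^ 2) = 0 := hΦ htb
    have e2 : g (-t) * (-t) ^ (2 * j₀) - -t * g' ((-t) ^ 2) = 0 :=
      hΦ (by simpa using htb)
    rw [pow_mul (-t), neg_sq, ← pow_mul] at e2
    have e3 : (g t + g (-t)) * t ^ (2 * j₀) = 0 := by linear_combination e1 + e2
    exact (mul_eq_zero.1 e3).resolve_right (pow_ne_zero _ ht)
  have hgc : ContinuousAt g 0 :=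
    (hg.differentiableAt (Metric.ball_mem_nhds 0 hR)).continuousAt
  have hlim : Tendsto (fun t => g t + g (-t)) (𝓝[≠] (0 : ℂ)) (𝓝 (g 0 + g 0)) := by
    have h1 : Tendsto (fun t : ℂ => g (-t)) (𝓝 0) (𝓝 (g 0)) :=
      hgc.tendsto.comp (by simpa using (continuous_neg (G := ℂ)).tendsto 0)
    exact (hgc.tendsto.add h1).mono_left nhdsWithin_le_nhds
  have h0 := tendsto_nhds_unique hlim (tendsto_const_nhds.congr' (hodd.mono fun t ht => ht.symm))
  rw [hg0, ← two_mul] at h0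
  exact hk ((mul_eq_zero.1 h0).resolve_left two_ne_zero)

/-! ### The resonance conditions -/

theorem quinticResonanceConditions_iff {Ω : Set ℂ} (hΩ : IsOpen Ω) (hΩc : IsPreconnected Ω)
    {α γ : ℂ → ℂ} (hα : AnalyticOnNhd ℂ α Ω) (hγ : AnalyticOnNhd ℂ γ Ω) :
    QuinticResonanceConditions Ω α γ ↔
      ∃ a b c : ℂ, ∀ z ∈ Ω, α z = a * z + b ∧ γ z = (a * z + b) ^ 2 / 16 + c := by
  constructor
  · rintro ⟨h1, h2⟩
    obtain ⟨a, ha⟩ := hΩ.exists_is_const_of_deriv_eq_zero hΩc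
      (fun z hz => (hα z hz).deriv.differentiableAt.differentiableWithinAt) h1
    obtain ⟨b, hb⟩ := hΩ.exists_is_const_of_deriv_eq_zero (f := fun z => α z - a * z) hΩc
      (fun z hz => ((hα z hz).differentiableAt.sub
        (differentiableAt_id.const_mul a)).differentiableWithinAt) fun z hz => by
        have := (hα z hz).differentiableAt.hasDerivAt.sub ((hasDerivAt_id z).const_mul a)
        rw [ha z hz, mul_one, sub_self] at this
        exact this.deriv
    obtain ⟨d, hd⟩ := hΩ.exists_is_const_of_deriv_eq_zero hΩc
      (fun z hz => (((hα z hz).differentiableAt.pow 2).sub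
        ((hγ z hz).differentiableAt.const_mul 16)).differentiableWithinAt) h2
    refine ⟨a, b, -(d / 16), fun z hz => ?_⟩
    have e1 : α z = a * z + b := by linear_combination hb z hz
    have e2 : α z ^ 2 - 16 * γ z = d := hd z hz
    rw [e1] at e2
    exact ⟨e1, by linear_combination -e2 / 16⟩
  · rintro ⟨a, b, c, h⟩
    have hd : ∀ z : ℂ, HasDerivAt (fun w => a * w + b) a z := fun z => by
      simpa using ((hasDerivAt_id z).const_mul a).add_const b
    refine ⟨fun z hz => ?_, fun z hz => ?_⟩
    · have h1 : deriv α =ᶠ[𝓝 z] fun _ => a := by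
        filter_upwards [hΩ.mem_nhds hz] with w hw
        have : α =ᶠ[𝓝 w] fun w => a * w + b := by
          filter_upwards [hΩ.mem_nhds hw] with x hx using (h x hx).1
        rw [this.deriv_eq, (hd w).deriv]
      rw [h1.deriv_eq, deriv_const]
    · have h1 : (fun w => α w ^ 2 - 16 * γ w) =ᶠ[𝓝 z] fun _ => -16 * c := by
        filter_upwards [hΩ.mem_nhds hz] with w hw
        rw [(h w hw).1, (h w hw).2]
        ring
      rw [h1.deriv_eq, deriv_const]

/-! ### The quasi-Painlevé property -/

/-- At every singularity that is reached along a path of finite length, the solution has an expansion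
in powers of `(z - z⋆) ^ (1 / 2)` starting with the exponent `-1 / 2`. -/
theorem ReachesMovableSingularity.exists_hasPuiseuxExpansion {Ω : Set ℂ} {a b c : ℂ} {β δ : ℂ → ℂ}
    {p : ℝ → ℂ} {F : ℝ → ℂ → ℂ} (hΩ : IsOpen Ω) (hβ : AnalyticOnNhd ℂ β Ω)
    (hδ : AnalyticOnNhd ℂ δ Ω) (H : ReachesMovableSingularity Ω (resonantRHS a b c β δ) p F) :
    ∃ k : ℕ → ℂ, k 0 ≠ 0 ∧ HasPuiseuxExpansion p F 2 1 k := by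
  obtain ⟨r, hr, Z, V, hV, hu, hZ, s₀, hs₀, hinv⟩ := H.exists_inverse hΩ hβ hδ
  exact exists_hasPuiseuxExpansion_of_inverse H.continuousOn H.tendsto_path H.continuation hr hV hu
    hZ hs₀ hinv

theorem proposition2 (Ω : Set ℂ) (hΩ : IsOpen Ω) (hΩc : IsPreconnected Ω)
    (β δ : ℂ → ℂ) (hβ : AnalyticOnNhd ℂ β Ω) (hδ : AnalyticOnNhd ℂ δ Ω) :
    -- the equations below are exactly those satisfying both resonance conditions
    (∀ α γ : ℂ → ℂ, AnalyticOnNhd ℂ α Ω → AnalyticOnNhd ℂ γ Ω →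
      (QuinticResonanceConditions Ω α γ ↔
        ∃ a b c : ℂ, ∀ z ∈ Ω, α z = a * z + b ∧ γ z = (a * z + b) ^ 2 / 16 + c)) ∧
    -- they have the quasi-Painlevé property, with square-root type algebraic poles
    (∀ a b c : ℂ,
      HasQuasiPainleveProperty Ω
        (quinticRHS (fun z => a * z + b) β (fun z => (a * z + b) ^ 2 / 16 + c) δ) 2 ∧
      -- and the Puiseux series at the singularities start with a term in `(z - z⋆) ^ (-1 / 2)`
      ∀ (p : ℝ → ℂ) (F : ℝ → ℂ → ℂ),
        ReachesMovableSingularity Ω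
          (quinticRHS (fun z => a * z + b) β (fun z => (a * z + b) ^ 2 / 16 + c) δ) p F →
        ∃ k : ℕ → ℂ, k 0 ≠ 0 ∧ HasPuiseuxExpansion p F 2 1 k) := by
  refine ⟨fun α γ hα hγ => quinticResonanceConditions_iff hΩ hΩc hα hγ, fun a b c =>
    ⟨fun p F H => ?_, fun p F H => H.exists_hasPuiseuxExpansion hΩ hβ hδ⟩⟩
  obtain ⟨k, hk, hexp⟩ := H.exists_hasPuiseuxExpansion hΩ hβ hδ
  refine ⟨two_pos, ⟨1, k, one_pos, hk, hexp⟩, fun m hm0 hm2 j₀ c' => ?_⟩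
  obtain rfl : m = 1 := by omega
  exact not_hasPuiseuxExpansion_one H.tendsto_path hk hexp j₀ c'
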